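/- Let $M_{0,n}$ ($n\ge 3$) be the space of $n$-tuples of distinct points of $\mathbb P^1=\mathbb P^1(\mathbb C)$ whose last three entries are $0,1,\infty$, and let $p:M_{0,n+1}\to M_{0,n}$, $(x_0,X)\mapsto X$, with fibre $\mathbb P^1\setminus X$ over $X$. Let $\Gamma_4=\langle\gamma_1,\dots,\gamma_4\mid\gamma_1\gamma_2\gamma_3\gamma_4=1\rangle$ and let $\theta:\Gamma_4\to S_3$ be given by $\theta(\gamma_1)=(12)$, $\theta(\gamma_2)=(23)$, $\theta(\gamma_3)=(23)$, $\theta(\gamma_4)=(12)$. Let $X\in M_{0,4}$, $x_0\in\mathbb P^1\setminus X$ and $x=(x_0,X)\in M_{0,5}$, and write $N_x=\pi_1(\mathbb P^1\setminus X,x_0)$, $K_x=\pi_1(M_{0,5},x)$, $H_X=\pi_1(M_{0,4},X)$, with the maps $i_*:N_x\to K_x$ and $p_*:K_x\to H_X$ induced by the inclusion of the fibre and by $p$. Let $\{[\alpha_i]\}_{i=1}^4$ be a geometric basis of $N_x$: for some permutation $\sigma$ there are smooth regular simple arcs from $x_0$ to the points $x_{\sigma(i)}$, meeting only at $x_0$,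 whose tangent vectors at $x_0$ have distinct directions and follow each other in counterclockwise order, and $\alpha_i$ runs along the $i$-th arc, once counterclockwise around a small circle about $x_{\sigma(i)}$, and back along the arc. Let $\chi:\Gamma_4\to N_x$ be the induced isomorphism, $\chi(\gamma_i)=[\alpha_i]$, and put $f=\theta\circ\chi^{-1}:N_x\to S_3$. Then: (1) There is no homomorphism $\tilde f:K_x\to S_3$ with $\tilde f\circ i_*=f$. Equivalently, for every identification of $K_x$ with a semidirect product $N_x\rtimes_\varepsilon H_X$ under which $i_*$ is the inclusion of $N_x$ and $p_*$ is the projection to $H_X$, no homomorphism $N_x\rtimes_\varepsilon H_X\to S_3$ extends $f$. (2) Let $(H_a,f_a)$ be any extension, that is, a subgroup $H_a\subseteq H_X$ of finite index together with a homomorphism $f_a:p_*^{-1}(H_a)\to S_3$ with $f_a\circ i_*=f$. Then $H_a\ne H_X$, and the connected pointed covering $q_a:(Y_a,y_a)\to(M_{0,4},X)$ with $q_{a*}\pi_1(Y_a,y_a)=H_a$ is not a homeomorphism, i.e. $Y_a\neq M_{0,4}$ as a covering of $M_{0,4}$. -/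

import Mathlib

noncomputable section

namespace GCurves

/-! ### Fundamental groups with concatenation of loops as product -/

/-- The fundamental group with product `[α] * [β] = [α followed by β]`. (Mathlib's
`FundamentalGroup` carries the opposite product.) -/
abbrev Pi1 (Y : Type*) [TopologicalSpace Y] (y : Y) : Type _ := (FundamentalGroup Y y)ᵐᵒᵖ

namespace Pi1

variable {Y Z : Type*} [TopologicalSpace Y] [TopologicalSpace Z]

/-- The class of a loop. -/
def of {y : Y} (c : Path y y) : Pi1 Y y :=
  MulOpposite.op (FundamentalGroup.fromPath (Path.Homotopic.Quotient.mk c))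

theorem of_trans {y : Y} (c d : Path y y) : of (c.trans d) = of c * of d := rfl

/-- The homomorphism induced by a continuous map. -/
def map (g : C(Y, Z)) (y : Y) : Pi1 Y y →* Pi1 Z (g y) :=
  MonoidHom.op (FundamentalGroup.map g y)

/-- The homomorphism induced by a pointed continuous map. -/
def mapOfEq (g : C(Y, Z)) {y : Y} {z : Z} (h : g y = z) : Pi1 Y y →* Pi1 Z z :=
  MonoidHom.op (FundamentalGroup.mapOfEq g h)

end Pi1

/-! ### The Riemann sphere and the moduli spaces of pointed lines -/

/-- The Riemann sphere. -/
abbrev P1 : Type := OnePoint ℂ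

/-- `ℙ¹ ∖ X`. -/
abbrev Punctured {n : ℕ} (X : Fin n → P1) : Type := {z : P1 // ∀ j, z ≠ X j}

/-- `M_{0,n}` for `n ≥ 3`: tuples of distinct points of `ℙ¹` whose last three entries are
`0, 1, ∞`. -/
abbrev M0 (n : ℕ) : Type :=
  {X : Fin n → P1 // Function.Injective X ∧
    ∀ i : Fin n, (i.val + 3 = n → X i = ((0 : ℂ) : P1)) ∧
      (i.val + 2 = n → X i = ((1 : ℂ) : P1)) ∧ (i.val + 1 = n → X i = OnePoint.infty)}

/-- The projection `p : M_{0,n+1} → M_{0,n}`, `(x₀, X) ↦ X`. -/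
def proj (n : ℕ) : C(M0 (n + 1), M0 n) where
  toFun x := ⟨fun i => x.1 i.succ, fun i j h => Fin.succ_injective n (x.2.1 h), fun i =>
    ⟨fun h => (x.2.2 i.succ).1 (by simp; omega), fun h => (x.2.2 i.succ).2.1 (by simp; omega),
      fun h => (x.2.2 i.succ).2.2 (by simp; omega)⟩⟩
  continuous_toFun := Continuous.subtype_mk
    (continuous_pi fun i => (continuous_apply i.succ).comp continuous_subtype_val) _

/-- The inclusion `ℙ¹ ∖ X → M_{0,n+1}`, `x₀ ↦ (x₀, X)`, of the fibre of `p` over `X`. -/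
def fibre {n : ℕ} (hn : 3 ≤ n) (X : M0 n) : C(Punctured X.1, M0 (n + 1)) where
  toFun z := ⟨Fin.cons z.1 X.1, by
    refine ⟨Fin.cons_injective_iff.2 ⟨?_, X.2.1⟩, ?_⟩
    · rintro ⟨j, hj⟩
      exact z.2 j hj.symm
    · intro i
      refine Fin.cases ?_ (fun j => ?_) i
      · refine ⟨fun h => ?_, fun h => ?_, fun h => ?_⟩ <;> simp at h <;> omega
      · simp only [Fin.cons_succ, Fin.val_succ]
        exact ⟨fun h => (X.2.2 j).1 (by omega), fun h => (X.2.2 j).2.1 (by omega),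
          fun h => (X.2.2 j).2.2 (by omega)⟩⟩
  continuous_toFun := by
    refine Continuous.subtype_mk (continuous_pi fun i => ?_) _
    refine Fin.cases ?_ (fun j => ?_) i
    · simpa using continuous_subtype_val
    · simpa using continuous_const

/-- `p (x₀, X) = X`. -/
theorem proj_fibre {n : ℕ} (hn : 3 ≤ n) (X : M0 n) (z : Punctured X.1) :
    proj n (fibre hn X z) = X := rfl

/-- `i_* : π₁(ℙ¹ ∖ X, x₀) → π₁(M_{0,n+1}, (x₀, X))`. -/
def fibreHom {n : ℕ} (hn : 3 ≤ n) (X : M0 n) (x₀ : Punctured X.1) :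
    Pi1 (Punctured X.1) x₀ →* Pi1 (M0 (n + 1)) (fibre hn X x₀) :=
  Pi1.map (fibre hn X) x₀

/-- `p_* : π₁(M_{0,n+1}, (x₀, X)) → π₁(M_{0,n}, X)`. -/
def projHom {n : ℕ} (hn : 3 ≤ n) (X : M0 n) (x₀ : Punctured X.1) :
    Pi1 (M0 (n + 1)) (fibre hn X x₀) →* Pi1 (M0 n) X :=
  Pi1.mapOfEq (proj n) (proj_fibre hn X x₀)

/-! ### Geometric bases -/

/-- The inverse of the standard holomorphic chart of `ℙ¹` centred at a point: `w ↦ y + w` at a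
finite point `y`, and `w ↦ 1 / w` at `∞`. -/
def param : P1 → ℂ → P1
  | OnePoint.some y, w => ((y + w : ℂ) : P1)
  | OnePoint.infty, w => if w = 0 then OnePoint.infty else ((w⁻¹ : ℂ) : P1)

/-- The standard holomorphic chart centred at a point: `z ↦ z - y` at a finite point `y`, and
`z ↦ 1 / z` at `∞`. It is only used near its centre (the value at the one point outside its
domain is irrelevant). -/
def coord : P1 → P1 → ℂ
  | OnePoint.some y, OnePoint.some z => z - y
  | OnePoint.some _, OnePoint.infty => 0
  | OnePoint.infty, OnePoint.some z => z⁻¹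
  | OnePoint.infty, OnePoint.infty => 0

/-- The closed round disc of radius `r` around `y`, in the chart centred at `y`. -/
def disc (y : P1) (r : ℝ) : Set P1 := param y '' Metric.closedBall 0 r

/-- A smooth regular simple arc in `ℙ¹`, parametrized by `[0,1]`. -/
structure IsSmoothArc {a b : P1} (c : Path a b) : Prop where
  injective : Function.Injective c
  smooth : ∀ t ∈ Set.Icc (0 : ℝ) 1, ContDiffWithinAt ℝ ((⊤ : ℕ∞) : WithTop ℕ∞)
    (fun s => coord (c.extend t) (c.extend s)) (Set.Icc 0 1) t
  regular : ∀ t ∈ Set.Icc (0 : ℝ) 1,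
    derivWithin (fun s => coord (c.extend t) (c.extend s)) (Set.Icc 0 1) t ≠ 0

/-- The initial tangent vector of an arc, in the chart centred at its initial point. -/
def initialTangent {a b : P1} (c : Path a b) : ℂ :=
  derivWithin (fun s => coord a (c.extend s)) (Set.Icc 0 1) 0

/-- `a` is the class of the loop in `ℙ¹ ∖ X` that starts at `x₀`, travels along the arc `c`
(joining `x₀` to `y`) until it reaches, at the time `t₀`, the boundary of the disc of radius `r`
around `y`, makes one complete counterclockwise tour of that boundary, and goes back to `x₀` along
`c`. The disc is so small that `c` does not leave its interior after the time `t₀`. -/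
def IsLoopAlong {n : ℕ} {X : Fin n → P1} {x₀ : Punctured X} {y : P1} (c : Path x₀.1 y) (r : ℝ)
    (a : Pi1 (Punctured X) x₀) : Prop :=
  ∃ (t₀ : unitInterval) (w : ℂ) (q : Punctured X) (β : Path x₀ q) (δ : Path q q),
    ‖w‖ = r ∧ c t₀ = param y w ∧
    (∀ t, t < t₀ → c t ∉ disc y r) ∧
    (∀ t, t₀ < t → c t ∈ param y '' Metric.ball 0 r) ∧
    (∀ s, (β s).1 = c (t₀ * s)) ∧
    (∀ s, (δ s).1 = param y (w * Complex.exp (2 * Real.pi * (s : ℝ) * Complex.I))) ∧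
    a = Pi1.of ((β.trans δ).trans β.symm)

/-- `α₁, …, αₙ` is a geometric basis of `π₁(ℙ¹ ∖ X, x₀)`. There are smooth regular arcs `c i` from
`x₀` to the points `X (σ i)`, for some permutation `σ`, which meet only at `x₀` and whose tangent
vectors at `x₀` have distinct directions and follow each other in counterclockwise order, there are
disjoint discs around the points of `X`, and `α i` is the class of the loop along `c i` around
`X (σ i)`. -/
def IsGeometricBasis {n : ℕ} (X : Fin n → P1) (x₀ : Punctured X)
    (α : Fin n → Pi1 (Punctured X) x₀) : Prop :=
  ∃ (σ : Equiv.Perm (Fin n)) (c : ∀ i, Path x₀.1 (X (σ i))) (φ : Fin n → ℝ) (r : Fin n → ℝ),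
    (∀ i, IsSmoothArc (c i)) ∧
    (∀ i j, i ≠ j → ∀ s t, c i s = c j t → c i s = x₀.1) ∧
    (∀ i, ∃ ρ : ℝ, 0 < ρ ∧ initialTangent (c i) = ρ * Complex.exp (φ i * Complex.I)) ∧
    StrictMono φ ∧ (∀ i j, φ j < φ i + 2 * Real.pi) ∧
    (∀ i, 0 < r i) ∧
    (∀ i j, i ≠ j → Disjoint (disc (X (σ i)) (r i)) (disc (X (σ j)) (r j))) ∧
    (∀ i, x₀.1 ∉ disc (X (σ i)) (r i)) ∧
    ∀ i, IsLoopAlong (c i) (r i) (α i)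

/-! ### The group `Γₙ` and extensions -/

/-- `Γₙ = ⟨γ₁, …, γₙ | γ₁ ⋯ γₙ = 1⟩` (with generators indexed from `0`). -/
abbrev Gam (n : ℕ) : Type :=
  PresentedGroup ({(List.ofFn fun i : Fin n => FreeGroup.of i).prod} : Set (FreeGroup (Fin n)))

/-- The generators of `Γₙ`. -/
def Gam.gen {n : ℕ} (i : Fin n) : Gam n := PresentedGroup.of i

/-- An extension of `(*, f)`, where `(*)` is a sequence `N → K → H` of groups with maps `i` and `p`,
and `f : N → G`: a subgroup `H_a` of finite index in `H` and a morphism `f_a : p⁻¹(H_a) → G` with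
`f_a ∘ i = f`. -/
structure Extension {N K H G : Type*} [Group N] [Group K] [Group H] [Group G]
    (i : N →* K) (p : K →* H) (f : N →* G) where
  /-- The subgroup `H_a`. -/
  Ha : Subgroup H
  finiteIndex : Ha.FiniteIndex
  /-- The morphism `f_a`. -/
  fa : Ha.comap p →* G
  extends_f : ∀ n : N, ∃ hn : i n ∈ Ha.comap p, fa ⟨i n, hn⟩ = f n

/-- `q : (Y, y) → (B, b)` is the connected pointed covering of `(B, b)` belonging to the subgroup
`S` of `π₁(B, b)`, that is, `q_* π₁(Y, y) = S`. -/
def IsCoveringOf {B Y : Type*} [TopologicalSpace B] [TopologicalSpace Y] {b : B}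
    (S : Subgroup (Pi1 B b)) (q : C(Y, B)) (y : Y) : Prop :=
  ConnectedSpace Y ∧ IsCoveringMap q ∧ ∃ h : q y = b, (Pi1.mapOfEq q h).range = S

/-- The values `(12), (23), (23), (12)`, with the letters `1, 2, 3` written as `0, 1, 2`. -/
def thetaVal : Fin 4 → Equiv.Perm (Fin 3) :=
  ![Equiv.swap 0 1, Equiv.swap 1 2, Equiv.swap 1 2, Equiv.swap 0 1]

/-- The datum `θ : Γ₄ → S₃`, `γ₁, γ₂, γ₃, γ₄ ↦ (12), (23), (23), (12)`. -/
def theta : Gam 4 →* Equiv.Perm (Fin 3) :=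
  PresentedGroup.toGroup (f := thetaVal) (by
    intro r hr
    rw [Set.mem_singleton_iff] at hr
    subst hr
    simp [List.ofFn_succ, thetaVal])

theorem theta_gen (i : Fin 4) : theta (Gam.gen i) = thetaVal i :=
  PresentedGroup.toGroup.of _

theorem three_le_four : 3 ≤ 4 := by norm_num

end GCurves

end

open GCurves

noncomputable section

namespace GCurves

open Set unitInterval

/-! Suppose `f` extends to `F` on the fundamental group of `M_{0,5}`. The loops around the three
finite punctures, suitably ordered, go to transpositions a, b, c. In `M_{0,5}` two neighbouring
punctures can make a full turn about their midpoint. If the moving point stays outside, this gives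
an element M that commutes with ab, the image of a loop enclosing the pair, and with c. If the point
turns along with the pair, it gives M·ab, which commutes with a and b. Suppose a ≠ b. Then ab is a
3-cycle, and M commutes with it and with a transposition, so M = 1 and ab commutes with a, which is
absurd. Hence a = b, and b = c in the same way (`perm_fin_three_relations`). The three loops
generate, so the image of `f` is cyclic; but (12) and (23) do not commute.

Presentations of the groups are avoided by working with `Holonomy`, which evaluates representations
on arbitrary curves. On the plane slit along vertical rays from the punctures a holonomy has a
potential. The potentials for downward and upward slits differ by a constant `jump j` on each
vertical strip, and `jump j * (jump (j+1))⁻¹` represents the loop around one puncture. That these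
loops generate is `exists_potential`; the braid relations are `exists_rotation_relations`. An
arbitrary `X` is moved to the punctures -2, 0, 2 by `exists_straightening`, and `apply_loop`
translates loops of the fibre. A geometric basis enters through the fact that its elements are
freely homotopic to small circles (`isConj_of_isLoopAlong`).

Everything is assembled in `not_exists_extension`. The statements on semidirect products and on
coverings follow formally. -/

/-- A nonabelian holonomy on a subset `U` of a space: it assigns a group element to every curve in
`U` (parametrized by `[0,1]`), is trivial on constant curves, and multiplicative around squares. -/
structure Holonomy {E : Type*} [TopologicalSpace E] (U : Set E) (G : Type*) [Group G] where
  val : (ℝ → E) → G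
  congr : ∀ {c d : ℝ → E}, EqOn c d (Icc 0 1) → val c = val d
  const : ∀ x ∈ U, val (fun _ => x) = 1
  square : ∀ T : ℝ → ℝ → E, ContinuousOn (Function.uncurry T) (Icc 0 1 ×ˢ Icc 0 1) →
    (∀ s ∈ Icc (0 : ℝ) 1, ∀ t ∈ Icc (0 : ℝ) 1, T s t ∈ U) →
    val (fun s => T s 0) * val (fun t => T 1 t) = val (fun t => T 0 t) * val (fun s => T s 1)

/-! ### Restriction, concatenation and reversal of curves -/

namespace Holonomy

variable {E E' : Type*} [TopologicalSpace E] [TopologicalSpace E'] {U : Set E} {V : Set E'}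
  {G : Type*} [Group G]

/-- The pullback of a holonomy along a map that is continuous on the relevant set. -/
def pullback (H : Holonomy U G) (f : E' → E) (hf : ContinuousOn f V) (hm : MapsTo f V U) :
    Holonomy V G where
  val c := H.val fun t => f (c t)
  congr h := H.congr fun t ht => by simp only [h ht]
  const x hx := H.const _ (hm hx)
  square T hT hU := H.square (fun s t => f (T s t))
    (hf.comp hT fun z hz => hU _ hz.1 _ hz.2) fun s hs t ht => hm (hU s hs t ht)

theorem lineMap_mem {a b s : ℝ} (ha : a ∈ Icc (0 : ℝ) 1) (hb : b ∈ Icc (0 : ℝ) 1)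
    (hs : s ∈ Icc (0 : ℝ) 1) : a + (b - a) * s ∈ Icc (0 : ℝ) 1 := by
  obtain ⟨ha, ha'⟩ := ha
  obtain ⟨hb, hb'⟩ := hb
  obtain ⟨hs, hs'⟩ := hs
  constructor <;> nlinarith

/-- The holonomy of the restriction of a curve to `[a, b]`. -/
def sub (H : Holonomy U G) (c : ℝ → E) (a b : ℝ) : G := H.val fun s => c (a + (b - a) * s)

theorem sub_zero_one (H : Holonomy U G) (c : ℝ → E) : H.sub c 0 1 = H.val c :=
  H.congr fun s _ => by simp

theorem sub_refl (H : Holonomy U G) {c : ℝ → E} (hU : MapsTo c (Icc 0 1) U) {a : ℝ}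
    (ha : a ∈ Icc (0 : ℝ) 1) : H.sub c a a = 1 := by
  rw [← H.const (c a) (hU ha)]
  exact H.congr fun s _ => by simp

/-- Apply the square law to a square one of whose sides is constant. No order among `a`, `b`, `d` is
assumed, so this also yields inverses. -/
theorem sub_mul (H : Holonomy U G) {c : ℝ → E} (hc : ContinuousOn c (Icc 0 1))
    (hU : MapsTo c (Icc 0 1) U) {a b d : ℝ} (ha : a ∈ Icc (0 : ℝ) 1) (hb : b ∈ Icc (0 : ℝ) 1)
    (hd : d ∈ Icc (0 : ℝ) 1) : H.sub c a b * H.sub c b d = H.sub c a d := by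
  have h := H.square (fun s t => c (a + ((b + (d - b) * t) - a) * s))
    (hc.comp (by fun_prop) fun z hz => lineMap_mem ha (lineMap_mem hb hd hz.2) hz.1)
    fun s hs t ht => hU (lineMap_mem ha (lineMap_mem hb hd ht) hs)
  simp only [mul_zero, add_zero, mul_one, add_sub_cancel, H.const _ (hU ha), one_mul] at h
  exact h

theorem sub_symm (H : Holonomy U G) {c : ℝ → E} (hc : ContinuousOn c (Icc 0 1))
    (hU : MapsTo c (Icc 0 1) U) {a b : ℝ} (ha : a ∈ Icc (0 : ℝ) 1) (hb : b ∈ Icc (0 : ℝ) 1) :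
    H.sub c b a = (H.sub c a b)⁻¹ := by
  rw [eq_inv_iff_mul_eq_one, H.sub_mul hc hU hb ha hb, H.sub_refl hU hb]

theorem val_reverse (H : Holonomy U G) {c : ℝ → E} (hc : ContinuousOn c (Icc 0 1))
    (hU : MapsTo c (Icc 0 1) U) : H.val (fun t => c (1 - t)) = (H.val c)⁻¹ := by
  rw [← H.sub_zero_one c, ← H.sub_symm hc hU (by simp) (by simp)]
  exact H.congr fun s _ => by ring_nf

theorem val_trans (H : Holonomy U G) {f : E' → E} (hf : ContinuousOn f V) (hm : MapsTo f V U)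
    {x y z : V} (p : Path x y) (q : Path y z) :
    H.val (fun t => f ((p.trans q).extend t)) =
      H.val (fun t => f (p.extend t)) * H.val (fun t => f (q.extend t)) := by
  have hc : ContinuousOn (fun t => f ((p.trans q).extend t)) (Icc 0 1) :=
    hf.comp (by fun_prop) fun t _ => Subtype.coe_prop _
  have hU : MapsTo (fun t => f ((p.trans q).extend t)) (Icc 0 1) U :=
    fun t _ => hm (Subtype.coe_prop _)
  rw [← H.sub_zero_one, ← H.sub_mul hc hU (b := 1 / 2) (by simp) (by norm_num) (by simp)]
  congr 1
  · refine H.congr fun t ht => ?_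
    dsimp only
    rw [Path.extend_trans_of_le_half _ _ (by linarith [ht.2])]
    ring_nf
  · refine H.congr fun t ht => ?_
    dsimp only
    rw [Path.extend_trans_of_half_le _ _ (by linarith [ht.1])]
    ring_nf

theorem val_symm (H : Holonomy U G) {f : E' → E} (hf : ContinuousOn f V) (hm : MapsTo f V U)
    {x y : V} (p : Path x y) :
    H.val (fun t => f (p.symm.extend t)) = (H.val (fun t => f (p.extend t)))⁻¹ := by
  rw [← H.val_reverse (c := fun t => f (p.extend t))
    (hf.comp (by fun_prop) fun t _ => Subtype.coe_prop _) fun t _ => hm (Subtype.coe_prop _)]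
  simp only [Path.extend_symm_apply]

/-- Freely homotopic loops have conjugate holonomy. -/
theorem isConj_of_square (H : Holonomy U G) (T : ℝ → ℝ → E)
    (hT : ContinuousOn (Function.uncurry T) (Icc 0 1 ×ˢ Icc 0 1))
    (hU : ∀ s ∈ Icc (0 : ℝ) 1, ∀ t ∈ Icc (0 : ℝ) 1, T s t ∈ U) (hl : ∀ t, T 1 t = T 0 t) :
    IsConj (H.val fun s => T s 0) (H.val fun s => T s 1) := by
  have h := H.square T hT hU
  simp only [hl] at h
  rw [isConj_comm, isConj_iff]
  exact ⟨H.val fun t => T 0 t, by rw [← h, mul_inv_cancel_right]⟩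

/-! ### Segments in convex sets, and passage from local to global -/

section Convex

variable {E : Type*} [NormedAddCommGroup E] [NormedSpace ℝ E] {U : Set E} (H : Holonomy U G)

/-- The holonomy of the segment from `x` to `y`. -/
def seg (x y : E) : G := H.val fun s => x + s • (y - x)

variable {H} {C : Set E}

theorem seg_mem (hC : Convex ℝ C) {x y : E} (hx : x ∈ C) (hy : y ∈ C) {s : ℝ}
    (hs : s ∈ Icc (0 : ℝ) 1) : x + s • (y - x) ∈ C :=
  hC.add_smul_sub_mem hx hy hs

/-- The straight-line homotopy from the curve to its chord stays in `C` and fixes both ends. -/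
theorem val_eq_seg (hC : Convex ℝ C) (hCU : C ⊆ U) {c : ℝ → E} (hc : ContinuousOn c (Icc 0 1))
    (hm : MapsTo c (Icc 0 1) C) : H.val c = H.seg (c 0) (c 1) := by
  have h0 : c 0 ∈ C := hm (by simp)
  have h1 : c 1 ∈ C := hm (by simp)
  have hc1 : ContinuousOn (fun z : ℝ × ℝ => c z.1) (Icc 0 1 ×ˢ Icc 0 1) :=
    hc.comp (by fun_prop) fun z hz => hz.1
  have h := H.square (fun s t => c s + t • ((c 0 + s • (c 1 - c 0)) - c s))
    (hc1.add (continuousOn_snd.smul (ContinuousOn.sub (by fun_prop) hc1)))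
    fun s hs t ht => hCU (seg_mem hC (hm hs) (seg_mem hC h0 h1 hs) ht)
  simp only [zero_smul, add_zero, one_smul, add_sub_cancel, sub_self, smul_zero] at h
  rwa [H.const _ (hCU h0), H.const _ (hCU h1), mul_one, one_mul] at h

theorem seg_self {x : E} (hx : x ∈ U) : H.seg x x = 1 := by
  rw [← H.const x hx]
  exact H.congr fun s _ => by simp

theorem seg_mul (hC : Convex ℝ C) (hCU : C ⊆ U) {x y z : E} (hx : x ∈ C) (hy : y ∈ C)
    (hz : z ∈ C) : H.seg x y * H.seg y z = H.seg x z := by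
  have h := H.square (fun s t => x + s • ((y + t • (z - y)) - x))
    (by
      simp only [Function.uncurry_def]
      fun_prop)
    fun s hs t ht => hCU (seg_mem hC hx (seg_mem hC hy hz ht) hs)
  simpa [seg, H.const _ (hCU hx)] using h

theorem seg_symm (hC : Convex ℝ C) (hCU : C ⊆ U) {x y : E} (hx : x ∈ C) (hy : y ∈ C) :
    H.seg y x = (H.seg x y)⁻¹ := by
  rw [eq_inv_iff_mul_eq_one, seg_mul hC hCU hy hx hy, seg_self (hCU hy)]

/-- The local-to-global principle: if the holonomy of all short segments along a curve lies, after
correction by the potential `A`, in the subgroup `S`, then so does that of the curve. -/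
theorem mem_of_local (S : Subgroup G) (A : E → G) {c : ℝ → E} (hc : ContinuousOn c (Icc 0 1))
    (hloc : ∀ t ∈ Icc (0 : ℝ) 1, ∃ C, IsOpen C ∧ Convex ℝ C ∧ C ⊆ U ∧ c t ∈ C ∧
      ∀ x ∈ C, ∀ y ∈ C, A x * H.seg x y * (A y)⁻¹ ∈ S) :
    A (c 0) * H.val c * (A (c 1))⁻¹ ∈ S := by
  have hU : MapsTo c (Icc 0 1) U := fun t ht => by
    obtain ⟨C, -, -, hCU, hC, -⟩ := hloc t ht
    exact hCU hC
  suffices h : A (c 0) * H.sub c 0 1 * (A (c 1))⁻¹ ∈ S by rwa [H.sub_zero_one] at h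
  -- The relation between parameters is transitive and holds for nearby ones; connectedness of the
  -- interval replaces a subdivision.
  refine isPreconnected_Icc.induction₂' (s := Icc (0 : ℝ) 1)
    (fun s t => A (c s) * H.sub c s t * (A (c t))⁻¹ ∈ S) ?_ ?_ (by simp) (by simp)
  · intro a ha
    obtain ⟨C, hCo, hC, hCU, hcC, hA⟩ := hloc a ha
    obtain ⟨ρ, hρ, hball⟩ := Metric.mem_nhdsWithin_iff.1 (hc a ha (hCo.mem_nhds hcC))
    have key : ∀ s ∈ Metric.ball a ρ ∩ Icc 0 1, ∀ t ∈ Metric.ball a ρ ∩ Icc 0 1,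
        A (c s) * H.sub c s t * (A (c t))⁻¹ ∈ S := by
      intro s hs t ht
      have hst : ∀ r ∈ Icc (0 : ℝ) 1, s + (t - s) * r ∈ Metric.ball a ρ ∩ Icc 0 1 := by
        intro r hr
        have := (((convex_ball a ρ).inter (convex_Icc 0 1))).add_smul_sub_mem hs ht hr
        rwa [smul_eq_mul, mul_comm] at this
      have := val_eq_seg (H := H) hC hCU (c := fun r => c (s + (t - s) * r))
        (hc.comp (by fun_prop) fun r hr => (hst r hr).2) fun r hr => hball (hst r hr)
      rw [sub, this]
      simpa using hA _ (hball hs) _ (hball ht)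
    have ha' : a ∈ Metric.ball a ρ ∩ Icc 0 1 := ⟨Metric.mem_ball_self hρ, ha⟩
    filter_upwards [inter_mem_nhdsWithin (Icc (0 : ℝ) 1) (Metric.ball_mem_nhds a hρ)] with b hb
    exact ⟨key _ ha' _ hb.symm, key _ hb.symm _ ha'⟩
  · intro r s t hr hs ht h1 h2
    rw [← H.sub_mul hc hU hr hs ht]
    convert S.mul_mem h1 h2 using 1
    group

end Convex

end Holonomy

/-! ### The holonomy of a representation of the fundamental group -/

section FromHom

variable {E : Type*} [TopologicalSpace E] {U : Set E} {G : Type*} [Group G]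

/-- A curve that stays in `U`, as a path in the subspace `U`. -/
def curvePath {c : ℝ → E} (hc : ContinuousOn c (Icc 0 1)) (hU : ∀ t ∈ Icc (0 : ℝ) 1, c t ∈ U) :
    Path (X := U) ⟨c 0, hU 0 (by simp)⟩ ⟨c 1, hU 1 (by simp)⟩ where
  toFun t := ⟨c t, hU t t.2⟩
  continuous_toFun := Continuous.subtype_mk (hc.comp_continuous continuous_subtype_val
    fun t => t.2) _
  source' := by simp
  target' := by simp

open Classical in
/-- A chosen path to `y` if there is one. -/
def basePath {y₀ y : U} (h : Joined y₀ y) : Path y₀ y :=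
  -- The constant path at the base point ensures that closing up a loop does not conjugate it.
  if h' : y₀ = y then (Path.refl y).cast h' rfl else h.somePath

/-- The class of the loop obtained by joining the ends of a path to the base point. -/
def closeUp {y₀ y z : U} (hy : Joined y₀ y) (hz : Joined y₀ z) (p : Path y z) : Pi1 U y₀ :=
  Pi1.of (((basePath hy).trans p).trans (basePath hz).symm)

theorem of_congr {Y : Type*} [TopologicalSpace Y] {y : Y} {p q : Path y y} (h : p.Homotopic q) :
    Pi1.of p = Pi1.of q := by
  unfold Pi1.of
  rw [Path.Homotopic.Quotient.eq.2 h]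

theorem closeUp_trans {y₀ y z w : U} (hy : Joined y₀ y) (hz : Joined y₀ z) (hw : Joined y₀ w)
    (p : Path y z) (q : Path z w) :
    closeUp hy hw (p.trans q) = closeUp hy hz p * closeUp hz hw q := by
  unfold closeUp
  rw [← Pi1.of_trans]
  refine of_congr (Path.Homotopic.Quotient.eq.1 ?_)
  simp only [Path.Homotopic.Quotient.mk_trans, Path.Homotopic.Quotient.mk_symm,
    Path.Homotopic.Quotient.trans_assoc]
  congr 2
  rw [← Path.Homotopic.Quotient.trans_assoc (Path.Homotopic.Quotient.symm _),
    Path.Homotopic.Quotient.symm_trans, Path.Homotopic.Quotient.refl_trans]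

theorem closeUp_congr {y₀ y z : U} (hy : Joined y₀ y) (hz : Joined y₀ z) {p q : Path y z}
    (h : p.Homotopic q) : closeUp hy hz p = closeUp hy hz q :=
  of_congr (((Path.Homotopic.refl _).hcomp h).hcomp (Path.Homotopic.refl _))

theorem closeUp_refl {y₀ y : U} (hy : Joined y₀ y) : closeUp hy hy (Path.refl y) = 1 := by
  unfold closeUp
  have : (1 : Pi1 U y₀) = Pi1.of (Path.refl y₀) := rfl
  rw [this]
  refine of_congr (Path.Homotopic.Quotient.eq.1 ?_)
  simp only [Path.Homotopic.Quotient.mk_trans, Path.Homotopic.Quotient.mk_symm,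
    Path.Homotopic.Quotient.mk_refl, Path.Homotopic.Quotient.trans_refl,
    Path.Homotopic.Quotient.trans_symm]

theorem closeUp_loop {y₀ : U} (p : Path y₀ y₀) :
    closeUp (Joined.refl y₀) (Joined.refl y₀) p = Pi1.of p := by
  unfold closeUp basePath
  simp only [dite_true]
  refine of_congr (Path.Homotopic.Quotient.eq.1 ?_)
  simp only [Path.Homotopic.Quotient.mk_trans,
    Path.Homotopic.Quotient.mk_refl, Path.Homotopic.Quotient.trans_refl, Path.cast_rfl_rfl,
    Path.refl_symm, Path.Homotopic.Quotient.refl_trans]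

/-- Paths around a square are homotopic. -/
theorem square_homotopic {Y : Type*} [TopologicalSpace Y] (T : C(I × I, Y)) {a b c d : Y}
    (p : Path a b) (q : Path b d) (p' : Path a c) (q' : Path c d)
    (hp : ∀ s, p s = T (s, 0)) (hq : ∀ t, q t = T (1, t)) (hp' : ∀ t, p' t = T (0, t))
    (hq' : ∀ s, q' s = T (s, 1)) : (p.trans q).Homotopic (p'.trans q') := by
  obtain rfl : T (0, 0) = a := by rw [← hp, p.source]
  obtain rfl : T (1, 0) = b := by rw [← hp, p.target]
  obtain rfl : T (0, 1) = c := by rw [← hp', p'.target]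
  obtain rfl : T (1, 1) = d := by rw [← hq, q.target]
  -- The two ways around the boundary are homotopic in the square itself, which is simply connected;
  -- push this forward by `T`.
  have : ContractibleSpace I := (convex_Icc (0 : ℝ) 1).contractibleSpace ⟨0, by simp⟩
  have h := (SimplyConnectedSpace.paths_homotopic
    ((Path.id.prod (Path.refl (0 : I))).trans ((Path.refl (1 : I)).prod Path.id))
    (((Path.refl (0 : I)).prod Path.id).trans (Path.id.prod (Path.refl (1 : I))))).map T
  simp only [Path.map_trans] at h
  convert h using 2 <;> ext t <;> simp [*]

open Classical in
/-- The holonomy of a curve that is determined by a representation of the fundamental group. -/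
def holonomyVal {y₀ : U} (F : Pi1 U y₀ →* G) (c : ℝ → E) : G :=
  if h : ∃ (hc : ContinuousOn c (Icc 0 1)) (hU : ∀ t ∈ Icc (0 : ℝ) 1, c t ∈ U),
      Joined y₀ ⟨c 0, hU 0 (by simp)⟩ then
    F (closeUp h.2.2 (h.2.2.trans ⟨curvePath h.1 h.2.1⟩) (curvePath h.1 h.2.1)) else 1

theorem continuousOn_of_path {y z : U} (p : Path y z) {c : ℝ → E}
    (h : ∀ t : I, (p t : E) = c t) : ContinuousOn c (Icc 0 1) := by
  rw [continuousOn_iff_continuous_domRestrict]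
  refine (continuous_subtype_val.comp p.continuous).congr fun t => ?_
  simp [h]

theorem holonomyVal_eq {y₀ : U} (F : Pi1 U y₀ →* G) {y z : U} (hy : Joined y₀ y)
    (hz : Joined y₀ z) (p : Path y z) {c : ℝ → E} (h : ∀ t : I, (p t : E) = c t) :
    holonomyVal F c = F (closeUp hy hz p) := by
  have hU : ∀ t ∈ Icc (0 : ℝ) 1, c t ∈ U := fun t ht => by
    rw [← h ⟨t, ht⟩]
    exact Subtype.coe_prop _
  obtain rfl : y = ⟨c 0, hU 0 (by simp)⟩ := Subtype.ext (by simpa using h 0)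
  obtain rfl : z = ⟨c 1, hU 1 (by simp)⟩ := Subtype.ext (by simpa using h 1)
  rw [holonomyVal, dif_pos ⟨continuousOn_of_path p h, hU, hy⟩]
  congr 2
  ext t
  simp [curvePath, h]

theorem holonomyVal_of_not_joined {y₀ : U} (F : Pi1 U y₀ →* G) {y z : U} (hy : ¬ Joined y₀ y)
    (p : Path y z) {c : ℝ → E} (h : ∀ t : I, (p t : E) = c t) : holonomyVal F c = 1 := by
  rw [holonomyVal, dif_neg]
  rintro ⟨hc, hU, hj⟩
  obtain rfl : y = ⟨c 0, hU 0 (by simp)⟩ := Subtype.ext (by simpa using h 0)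
  exact hy hj

/-- The holonomy determined by a representation of the fundamental group; it is trivial outside the
path component of the base point. -/
def holonomyOfHom {y₀ : U} (F : Pi1 U y₀ →* G) : Holonomy U G where
  val := holonomyVal F
  congr {c d} h := by
    have aux : ∀ {c d : ℝ → E}, EqOn c d (Icc 0 1) → ∀ (hc : ContinuousOn c (Icc 0 1))
        (hU : ∀ t ∈ Icc (0 : ℝ) 1, c t ∈ U), holonomyVal F c = holonomyVal F d := by
      intro c d h hc hU
      by_cases hy : Joined y₀ ⟨c 0, hU 0 (by simp)⟩
      · rw [holonomyVal_eq F hy (hy.trans ⟨curvePath hc hU⟩) (curvePath hc hU) fun t => rfl,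
          holonomyVal_eq F hy (hy.trans ⟨curvePath hc hU⟩) (curvePath hc hU) fun t => h t.2]
      · rw [holonomyVal_of_not_joined F hy (curvePath hc hU) fun t => rfl,
          holonomyVal_of_not_joined F hy (curvePath hc hU) fun t => h t.2]
    by_cases hc : ∃ (_ : ContinuousOn c (Icc 0 1)), ∀ t ∈ Icc (0 : ℝ) 1, c t ∈ U
    · exact aux h hc.1 hc.2
    by_cases hd : ∃ (_ : ContinuousOn d (Icc 0 1)), ∀ t ∈ Icc (0 : ℝ) 1, d t ∈ U
    · exact (aux h.symm hd.1 hd.2).symm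
    rw [holonomyVal, holonomyVal, dif_neg fun h => hc ⟨h.1, h.2.1⟩,
      dif_neg fun h => hd ⟨h.1, h.2.1⟩]
  const x hx := by
    by_cases hy : Joined y₀ ⟨x, hx⟩
    · rw [holonomyVal_eq F hy hy (Path.refl _) fun t => rfl, closeUp_refl, map_one]
    · rw [holonomyVal_of_not_joined F hy (Path.refl _) fun t => rfl]
  square T hT hU := by
    have h0 : (0 : ℝ) ∈ Icc (0 : ℝ) 1 := by simp
    have h1 : (1 : ℝ) ∈ Icc (0 : ℝ) 1 := by simp
    let p := curvePath (c := fun s => T s 0)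
      (hT.comp (f := fun s => (s, 0)) (by fun_prop) fun s hs => ⟨hs, h0⟩) fun s hs => hU s hs 0 h0
    let q := curvePath (c := fun t => T 1 t)
      (hT.comp (f := fun t => (1, t)) (by fun_prop) fun t ht => ⟨h1, ht⟩) fun t ht => hU 1 h1 t ht
    let p' := curvePath (c := fun t => T 0 t)
      (hT.comp (f := fun t => (0, t)) (by fun_prop) fun t ht => ⟨h0, ht⟩) fun t ht => hU 0 h0 t ht
    let q' := curvePath (c := fun s => T s 1)
      (hT.comp (f := fun s => (s, 1)) (by fun_prop) fun s hs => ⟨hs, h1⟩) fun s hs => hU s hs 1 h1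
    by_cases hy : Joined y₀ ⟨T 0 0, hU 0 h0 0 h0⟩
    · have hb := hy.trans ⟨p⟩
      have hc := hy.trans ⟨p'⟩
      have hd := hb.trans ⟨q⟩
      rw [holonomyVal_eq F hy hb p fun t => rfl, holonomyVal_eq F hb hd q fun t => rfl,
        holonomyVal_eq F hy hc p' fun t => rfl, holonomyVal_eq F hc hd q' fun t => rfl,
        ← map_mul, ← map_mul, ← closeUp_trans, ← closeUp_trans]
      refine congrArg F (closeUp_congr _ _ (square_homotopic
        ⟨fun z => ⟨T z.1 z.2, hU _ z.1.2 _ z.2.2⟩, ?_⟩ p q p' q' (fun _ => rfl) (fun _ => rfl)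
        (fun _ => rfl) fun _ => rfl))
      exact Continuous.subtype_mk (hT.comp_continuous (f := fun z : I × I => ((z.1 : ℝ), (z.2 : ℝ)))
        (by fun_prop) fun z => ⟨z.1.2, z.2.2⟩) _
    -- All four corners miss the component of the base point, so every side takes the default value
    -- `1`.
    · have hb : ¬ Joined y₀ ⟨T 1 0, hU 1 h1 0 h0⟩ := fun h => hy (h.trans ⟨p.symm⟩)
      have hc : ¬ Joined y₀ ⟨T 0 1, hU 0 h0 1 h1⟩ := fun h => hy (h.trans ⟨p'.symm⟩)
      rw [holonomyVal_of_not_joined F hy p fun t => rfl,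
        holonomyVal_of_not_joined F hb q fun t => rfl,
        holonomyVal_of_not_joined F hy p' fun t => rfl,
        holonomyVal_of_not_joined F hc q' fun t => rfl]

theorem holonomyOfHom_loop {y₀ : U} (F : Pi1 U y₀ →* G) (p : Path y₀ y₀) :
    (holonomyOfHom F).val (fun t => p.extend t) = F (Pi1.of p) := by
  rw [← closeUp_loop]
  exact holonomyVal_eq F _ _ p fun t => by simp

end FromHom

/-! ### The standard punctured plane: strips, half planes and cut planes -/

/-- The standard three punctures `-2, 0, 2`. -/
def node (k : Fin 3) : ℝ := 2 * (k.val : ℝ) - 2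

/-- The plane with the three standard punctures removed. -/
def standardPlane : Set ℂ := {z | ∀ k, z ≠ (node k : ℂ)}

/-- The vertical strips between the punctures. -/
def strip (j : ℕ) : Set ℂ :=
  {z | ∀ k : Fin 3, (k.val < j → node k < z.re) ∧ (j ≤ k.val → z.re < node k)}

/-- The open half plane above (`ς = 1`) or below (`ς = -1`) the real axis. -/
def halfPlane (ς : ℝ) : Set ℂ := {z | 0 < ς * z.im}

/-- The plane cut along the vertical rays going down (`ς = 1`) or up (`ς = -1`) from the
punctures. -/
def cutPlane (ς : ℝ) : Set ℂ := {z | ∀ k, z.re = node k → 0 < ς * z.im}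

/-- The midpoint of a strip. -/
def stripPoint (j : ℕ) : ℂ := ((2 * (j : ℝ) - 3 : ℝ) : ℂ)

/-- A point of the half plane vertically above or below `z`. -/
def lift (ς : ℝ) (z : ℂ) : ℂ := ⟨z.re, z.im + ς * (|z.im| + 1)⟩

theorem node_injective : Function.Injective node := fun a b h => by
  unfold node at h
  have : (a.val : ℝ) = b.val := by linarith
  exact Fin.ext (by exact_mod_cast this)

theorem stripPoint_mem (j : ℕ) : stripPoint j ∈ strip j := fun k => by
  simp only [stripPoint, node, Complex.ofReal_re]
  constructor <;> intro h
  · have : (k.val : ℝ) + 1 ≤ j := by exact_mod_cast h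
    linarith
  · have : (j : ℝ) ≤ k.val := by exact_mod_cast h
    linarith

theorem strip_subset_cutPlane (j : ℕ) (ς : ℝ) : strip j ⊆ cutPlane ς := fun z hz k hk => by
  rcases lt_or_ge k.val j with h | h
  · exact absurd hk ((hz k).1 h).ne'
  · exact absurd hk ((hz k).2 h).ne

theorem halfPlane_subset_cutPlane (ς : ℝ) : halfPlane ς ⊆ cutPlane ς := fun _ hz _ _ => hz

theorem cutPlane_subset (ς : ℝ) : cutPlane ς ⊆ standardPlane := fun z hz k hk => by
  have := hz k (by rw [hk, Complex.ofReal_re])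
  rw [hk] at this
  simp at this

theorem exists_mem_strip {z : ℂ} (hz : ∀ k, z.re ≠ node k) : ∃ j ≤ 3, z ∈ strip j := by
  have h0 := hz 0
  have h1 := hz 1
  have h2 := hz 2
  simp only [node, strip, mem_ofPred_eq, Fin.forall_fin_succ] at *
  norm_num at *
  rcases lt_or_gt_of_ne h0 with h0 | h0
  · exact ⟨0, by norm_num, by norm_num; constructor <;> [linarith; constructor <;> linarith]⟩
  rcases lt_or_gt_of_ne h1 with h1 | h1
  · exact ⟨1, by norm_num, by norm_num; constructor <;> [linarith; constructor <;> linarith]⟩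
  rcases lt_or_gt_of_ne h2 with h2 | h2
  · exact ⟨2, by norm_num, by norm_num; constructor <;> [linarith; constructor <;> linarith]⟩
  · exact ⟨3, by norm_num, by norm_num; constructor <;> [linarith; constructor <;> linarith]⟩

theorem isOpen_strip (j : ℕ) : IsOpen (strip j) := by
  simp only [strip, ofPred_forall, ofPred_and]
  refine isOpen_iInter_of_finite fun k => (isOpen_iInter_of_finite fun _ => ?_).inter
    (isOpen_iInter_of_finite fun _ => ?_)
  · exact isOpen_lt continuous_const Complex.continuous_re
  · exact isOpen_lt Complex.continuous_re continuous_const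

theorem convex_strip (j : ℕ) : Convex ℝ (strip j) := by
  simp only [strip, ofPred_forall, ofPred_and]
  refine convex_iInter fun k => (convex_iInter fun _ => ?_).inter (convex_iInter fun _ => ?_)
  · exact convex_halfSpace_re_gt _
  · exact convex_halfSpace_re_lt _

theorem isOpen_halfPlane (ς : ℝ) : IsOpen (halfPlane ς) :=
  isOpen_lt continuous_const (continuous_const.mul Complex.continuous_im)

theorem convex_halfPlane (ς : ℝ) : Convex ℝ (halfPlane ς) :=
  convex_halfSpace_gt (f := fun z : ℂ => ς * z.im)
    ⟨fun x y => by simp [mul_add], fun c x => by simp; ring⟩ 0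

theorem lift_mem_halfPlane {ς : ℝ} (hς : ς * ς = 1) (z : ℂ) : lift ς z ∈ halfPlane ς := by
  have h := neg_abs_le z.im
  have h' := le_abs_self z.im
  simp only [halfPlane, lift, mem_ofPred_eq]
  rcases mul_self_eq_one_iff.1 hς with rfl | rfl <;> linarith

theorem lift_mem_strip {j : ℕ} {ς : ℝ} {z : ℂ} (hz : z ∈ strip j) : lift ς z ∈ strip j := hz

/-- The open convex pieces of a cut plane. -/
def IsPiece (ς : ℝ) (C : Set ℂ) : Prop := C = halfPlane ς ∨ ∃ j ≤ 3, C = strip j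

theorem IsPiece.isOpen {ς : ℝ} {C : Set ℂ} (h : IsPiece ς C) : IsOpen C := by
  obtain rfl | ⟨j, -, rfl⟩ := h
  exacts [isOpen_halfPlane ς, isOpen_strip j]

theorem IsPiece.convex {ς : ℝ} {C : Set ℂ} (h : IsPiece ς C) : Convex ℝ C := by
  obtain rfl | ⟨j, -, rfl⟩ := h
  exacts [convex_halfPlane ς, convex_strip j]

theorem IsPiece.subset_cutPlane {ς : ℝ} {C : Set ℂ} (h : IsPiece ς C) : C ⊆ cutPlane ς := by
  obtain rfl | ⟨j, -, rfl⟩ := h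
  exacts [halfPlane_subset_cutPlane ς, strip_subset_cutPlane j ς]

theorem IsPiece.subset {ς : ℝ} {C : Set ℂ} (h : IsPiece ς C) : C ⊆ standardPlane :=
  h.subset_cutPlane.trans (cutPlane_subset ς)

theorem IsPiece.lift_mem {ς : ℝ} (hς : ς * ς = 1) {C : Set ℂ} (h : IsPiece ς C) {z : ℂ}
    (hz : z ∈ C) : lift ς z ∈ C := by
  obtain rfl | ⟨j, -, rfl⟩ := h
  exacts [lift_mem_halfPlane hς z, lift_mem_strip hz]

theorem exists_isPiece {ς : ℝ} {z : ℂ} (hz : z ∈ cutPlane ς) : ∃ C, IsPiece ς C ∧ z ∈ C := by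
  by_cases h : ∃ k, z.re = node k
  · obtain ⟨k, hk⟩ := h
    exact ⟨_, Or.inl rfl, hz k hk⟩
  · obtain ⟨j, hj, hz⟩ := exists_mem_strip (not_exists.1 h)
    exact ⟨_, Or.inr ⟨j, hj, rfl⟩, hz⟩

theorem mul_self_one : (1 : ℝ) * 1 = 1 := by norm_num

theorem mul_self_neg_one : (-1 : ℝ) * -1 = 1 := by norm_num

/-! ### Potentials on the cut planes and their jumps -/

namespace Holonomy

variable {G : Type*} [Group G] (H : Holonomy standardPlane G)

/-- The potential of the holonomy on a cut plane, normalized at `± i`. -/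
def pot (ς : ℝ) (z : ℂ) : G := H.seg ⟨0, ς⟩ (lift ς z) * H.seg (lift ς z) z

/-- The jump between the two potentials in a strip. -/
def jump (j : ℕ) : G := H.pot 1 (stripPoint j) * (H.pot (-1) (stripPoint j))⁻¹

variable {H}

/-- Every point of a piece can be moved vertically to its lift without leaving the piece, and the
lifts lie in a convex half plane together with the base point. So only triangles in convex sets are
needed. -/
theorem seg_eq_pot {ς : ℝ} (hς : ς * ς = 1) {C : Set ℂ} (hC : IsPiece ς C) {x y : ℂ}
    (hx : x ∈ C) (hy : y ∈ C) : H.seg x y = (H.pot ς x)⁻¹ * H.pot ς y := by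
  have hhalf : IsPiece ς (halfPlane ς) := Or.inl rfl
  have hi : (⟨0, ς⟩ : ℂ) ∈ halfPlane ς := by simp [halfPlane, hς]
  have h1 := seg_mul (H := H) hhalf.convex hhalf.subset hi (lift_mem_halfPlane hς x)
    (lift_mem_halfPlane hς y)
  have h2 := seg_mul (H := H) hC.convex hC.subset hx (hC.lift_mem hς hx) (hC.lift_mem hς hy)
  have h3 := seg_mul (H := H) hC.convex hC.subset hx (hC.lift_mem hς hy) hy
  have h4 := seg_symm (H := H) hC.convex hC.subset hx (hC.lift_mem hς hx)
  rw [pot, pot, ← h1, ← h3, ← h2, h4]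
  group

/-- The pieces cover the cut plane, so `mem_of_local` applies with the trivial subgroup. -/
theorem val_eq_pot {ς : ℝ} (hς : ς * ς = 1) {c : ℝ → ℂ} (hc : ContinuousOn c (Icc 0 1))
    (hm : MapsTo c (Icc 0 1) (cutPlane ς)) : H.val c = (H.pot ς (c 0))⁻¹ * H.pot ς (c 1) := by
  have h := mem_of_local (H := H) ⊥ (H.pot ς) hc fun t ht => by
    obtain ⟨C, hC, hz⟩ := exists_isPiece (hm ht)
    refine ⟨C, hC.isOpen, hC.convex, hC.subset, hz, fun x hx y hy => ?_⟩
    rw [seg_eq_pot hς hC hx hy, Subgroup.mem_bot]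
    group
  rw [Subgroup.mem_bot, mul_inv_eq_one] at h
  rw [← h, inv_mul_cancel_left]

/-- Both potentials integrate the same segment holonomy on the convex strip, so their quotient is
constant there. -/
theorem pot_eq_jump_mul {j : ℕ} (hj : j ≤ 3) {z : ℂ} (hz : z ∈ strip j) :
    H.pot 1 z = H.jump j * H.pot (-1) z := by
  have h1 := seg_eq_pot (H := H) mul_self_one (Or.inr ⟨j, hj, rfl⟩) (stripPoint_mem j) hz
  have h2 := seg_eq_pot (H := H) mul_self_neg_one (Or.inr ⟨j, hj, rfl⟩) (stripPoint_mem j) hz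
  rw [h1, inv_mul_eq_iff_eq_mul] at h2
  rw [h2, jump]
  group

/-- The jumps generate the holonomy, up to a change of the base points. -/
theorem exists_potential (S : Subgroup G) (hS : ∀ j ≤ 3, H.jump j * (H.jump 0)⁻¹ ∈ S) :
    ∃ A : ℂ → G, ∀ c : ℝ → ℂ, ContinuousOn c (Icc 0 1) → MapsTo c (Icc 0 1) standardPlane →
      A (c 0) * H.val c * (A (c 1))⁻¹ ∈ S := by
  classical
  -- The slits are filled in with the lower potential, scaled to agree with the upper one in strip
  -- 0. In the lower part of strip `j` the two choices differ by `jump j * (jump 0)⁻¹`, which lies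
  -- in `S`.
  let A : ℂ → G := fun z => if z ∈ cutPlane 1 then H.pot 1 z else H.jump 0 * H.pot (-1) z
  have hA : ∀ z ∈ halfPlane (-1), ∃ s ∈ S, A z = s * (H.jump 0 * H.pot (-1) z) := by
    intro z hz
    by_cases h : z ∈ cutPlane 1
    · obtain ⟨C, rfl | ⟨j, hj, rfl⟩, hzC⟩ := exists_isPiece h
      · simp only [halfPlane, mem_ofPred_eq] at hz hzC
        linarith
      · refine ⟨_, hS j hj, ?_⟩
        simp only [A, if_pos h, pot_eq_jump_mul hj hzC]
        group
    · exact ⟨1, S.one_mem, by simp [A, if_neg h]⟩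
  refine ⟨A, fun c hc hm => mem_of_local S A hc fun t ht => ?_⟩
  by_cases h : c t ∈ cutPlane 1
  · obtain ⟨C, hC, hz⟩ := exists_isPiece h
    refine ⟨C, hC.isOpen, hC.convex, hC.subset, hz, fun x hx y hy => ?_⟩
    simp only [A, if_pos (hC.subset_cutPlane hx), if_pos (hC.subset_cutPlane hy)]
    rw [seg_eq_pot mul_self_one hC hx hy]
    convert S.one_mem
    group
  · have hlow : c t ∈ halfPlane (-1) := by
      simp only [cutPlane, mem_ofPred_eq, not_forall] at h
      obtain ⟨k, hk, him⟩ := h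
      have hne : (c t).im ≠ 0 := fun h0 => hm ht k (Complex.ext (by simpa using hk) (by simpa))
      simp only [halfPlane, mem_ofPred_eq]
      have := lt_of_le_of_ne (not_lt.1 him) (by simpa using hne)
      linarith
    have hC : IsPiece (-1) (halfPlane (-1)) := Or.inl rfl
    refine ⟨_, hC.isOpen, hC.convex, hC.subset, hlow, fun x hx y hy => ?_⟩
    obtain ⟨s, hs, hsx⟩ := hA x hx
    obtain ⟨s', hs', hsy⟩ := hA y hy
    rw [seg_eq_pot mul_self_neg_one hC hx hy, hsx, hsy]
    convert S.mul_mem hs (S.inv_mem hs') using 1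
    group

theorem val_eq_of_halves {ς : ℝ} (hς : ς * ς = 1) {c : ℝ → ℂ} (hc : ContinuousOn c (Icc 0 1))
    (h1 : MapsTo c (Icc 0 (1 / 2)) (cutPlane ς)) (h2 : MapsTo c (Icc (1 / 2) 1) (cutPlane (-ς))) :
    H.val c = (H.pot ς (c 0))⁻¹ * H.pot ς (c (1 / 2)) *
      ((H.pot (-ς) (c (1 / 2)))⁻¹ * H.pot (-ς) (c 1)) := by
  have hU : MapsTo c (Icc 0 1) standardPlane := fun t ht => by
    rcases le_total t (1 / 2) with h | h
    · exact cutPlane_subset _ (h1 ⟨ht.1, h⟩)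
    · exact cutPlane_subset _ (h2 ⟨h, ht.2⟩)
  rw [← H.sub_zero_one, ← H.sub_mul hc hU (b := 1 / 2) (by simp) (by norm_num) (by simp)]
  have e1 := val_eq_pot (H := H) hς (c := fun s => c (0 + (1 / 2 - 0) * s))
    (hc.comp (by fun_prop) fun s hs => ⟨by linarith [hs.1], by linarith [hs.2]⟩)
    fun s hs => h1 ⟨by linarith [hs.1], by linarith [hs.2]⟩
  have e2 := val_eq_pot (H := H) (ς := -ς) (by linarith) (c := fun s => c (1 / 2 + (1 - 1 / 2) * s))
    (hc.comp (by fun_prop) fun s hs => ⟨by linarith [hs.1], by linarith [hs.2]⟩)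
    fun s hs => h2 ⟨by linarith [hs.1], by linarith [hs.2]⟩
  rw [sub, sub, e1, e2]
  norm_num

/-- The holonomy of a loop around a single puncture. -/
theorem isConj_jump {j : ℕ} (hj : j < 3) {c : ℝ → ℂ} (hc : ContinuousOn c (Icc 0 1))
    (h1 : MapsTo c (Icc 0 (1 / 2)) (cutPlane (-1))) (h2 : MapsTo c (Icc (1 / 2) 1) (cutPlane 1))
    (h01 : c 1 = c 0) (h0 : c 0 ∈ strip j) (hh : c (1 / 2) ∈ strip (j + 1)) :
    IsConj (H.val c) (H.jump j * (H.jump (j + 1))⁻¹) := by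
  rw [val_eq_of_halves mul_self_neg_one hc h1 (by rwa [neg_neg]), neg_neg, h01,
    pot_eq_jump_mul (by omega) h0, pot_eq_jump_mul (by omega) hh, isConj_iff]
  exact ⟨H.jump j * H.pot (-1) (c 0), by group⟩

end Holonomy

/-! ### Rotating two neighbouring punctures -/

/-- Configurations of a point and three more points in the plane, all distinct. -/
def configurations : Set (ℂ × (Fin 3 → ℂ)) :=
  {p | Function.Injective p.2 ∧ ∀ k, p.1 ≠ p.2 k}

/-- The standard punctures as points of the plane. -/
def nodes (k : Fin 3) : ℂ := node k

/-- Rotation about `e` by the angle `2πt`. -/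
def rot (e : ℝ) (t : ℝ) (z : ℂ) : ℂ := e + (z - e) * Complex.exp (2 * Real.pi * t * Complex.I)

/-- Rotation of the punctures at distance one from `e`. -/
def rotNodes (e : ℝ) (t : ℝ) (k : Fin 3) : ℂ :=
  if (node k - e) ^ 2 = 1 then rot e t (nodes k) else nodes k

@[fun_prop]
theorem continuous_rot {X : Type*} [TopologicalSpace X] {e : ℝ} {f : X → ℝ} {g : X → ℂ} {s : Set X}
    (hf : ContinuousOn f s) (hg : ContinuousOn g s) :
    ContinuousOn (fun x => rot e (f x) (g x)) s := by
  unfold rot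
  fun_prop

@[fun_prop]
theorem continuous_rotNodes {X : Type*} [TopologicalSpace X] {e : ℝ} {f : X → ℝ} {s : Set X}
    (hf : ContinuousOn f s) : ContinuousOn (fun x => rotNodes e (f x)) s := by
  refine continuousOn_pi.2 fun k => ?_
  unfold rotNodes
  split_ifs <;> fun_prop

theorem norm_rot_sub (e t : ℝ) (z : ℂ) : ‖rot e t z - e‖ = ‖z - e‖ := by
  have : (2 * Real.pi * t * Complex.I : ℂ) = ((2 * Real.pi * t : ℝ) : ℂ) * Complex.I := by
    push_cast
    ring
  rw [rot, add_sub_cancel_left, norm_mul, this, Complex.norm_exp_ofReal_mul_I, mul_one]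

theorem rot_injective (e t : ℝ) : Function.Injective (rot e t) := fun z w h => by
  simpa [rot] using h

@[simp] theorem rot_zero (e : ℝ) (z : ℂ) : rot e 0 z = z := by simp [rot]

@[simp] theorem rot_one (e : ℝ) (z : ℂ) : rot e 1 z = z := by simp [rot]

@[simp] theorem rotNodes_zero (e : ℝ) : rotNodes e 0 = nodes := by
  ext k
  simp [rotNodes]

@[simp] theorem rotNodes_one (e : ℝ) : rotNodes e 1 = nodes := by
  ext k
  simp [rotNodes]

/-- The centres ±1 are the midpoints of neighbouring punctures: two punctures are at distance 1 and
the third is at distance 3. -/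
theorem node_sub_sq {e : ℝ} (he : e = -1 ∨ e = 1) (k : Fin 3) :
    (node k - e) ^ 2 = 1 ∨ (node k - e) ^ 2 = 9 := by
  rcases he with rfl | rfl <;> fin_cases k <;> norm_num [node]

theorem far_unique {e : ℝ} (he : e = -1 ∨ e = 1) {k l : Fin 3} (hk : (node k - e) ^ 2 ≠ 1)
    (hl : (node l - e) ^ 2 ≠ 1) : k = l := by
  rcases he with rfl | rfl <;> revert hk hl <;> fin_cases k <;> fin_cases l <;> norm_num [node]

theorem norm_nodes_sub (e : ℝ) (k : Fin 3) : ‖nodes k - e‖ ^ 2 = (node k - e) ^ 2 := by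
  rw [nodes, ← Complex.ofReal_sub, Complex.norm_real, Real.norm_eq_abs, sq_abs]

theorem norm_nodes_sub_near {e : ℝ} {k : Fin 3} (hk : (node k - e) ^ 2 = 1) :
    ‖nodes k - e‖ = 1 := by
  have := norm_nodes_sub e k
  rw [hk] at this
  nlinarith [norm_nonneg (nodes k - e)]

theorem norm_nodes_sub_far {e : ℝ} (he : e = -1 ∨ e = 1) {k : Fin 3}
    (hk : (node k - e) ^ 2 ≠ 1) : ‖nodes k - e‖ = 3 := by
  have := norm_nodes_sub e k
  rw [(node_sub_sq he k).resolve_left hk] at this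
  nlinarith [norm_nonneg (nodes k - e)]

theorem rotNodes_injective {e : ℝ} (he : e = -1 ∨ e = 1) (t : ℝ) :
    Function.Injective (rotNodes e t) := by
  intro k l h
  unfold rotNodes at h
  have key : ∀ k l : Fin 3, (node k - e) ^ 2 = 1 → (node l - e) ^ 2 ≠ 1 →
      rot e t (nodes k) ≠ nodes l := fun k l hk hl h => by
    have := norm_rot_sub e t (nodes k)
    rw [h, norm_nodes_sub_near hk, norm_nodes_sub_far he hl] at this
    norm_num at this
  split_ifs at h with hk hl hl
  · exact node_injective (Complex.ofReal_injective (rot_injective e t h))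
  · exact absurd h (key k l hk hl)
  · exact absurd h.symm (key l k hl hk)
  · exact far_unique he hk hl

/-- The point and the near pair undergo the same rotation, and the fixed puncture lies too far out
to be met. -/
theorem rot_mem_configurations {e : ℝ} (he : e = -1 ∨ e = 1) (t : ℝ) {z : ℂ}
    (hz : z ∈ standardPlane) (hn : ‖z - e‖ < 3) :
    (rot e t z, rotNodes e t) ∈ configurations := by
  refine ⟨rotNodes_injective he t, fun k h => ?_⟩
  dsimp only at h
  unfold rotNodes at h
  split_ifs at h with hk
  · exact hz k (rot_injective e t h)
  · have := norm_rot_sub e t z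
    rw [h, norm_nodes_sub_far he hk] at this
    linarith

theorem mem_configurations_of_outside {e : ℝ} (he : e = -1 ∨ e = 1) (t : ℝ) {z : ℂ}
    (hz : z ∈ standardPlane) (hn : 1 < ‖z - e‖) : (z, rotNodes e t) ∈ configurations := by
  refine ⟨rotNodes_injective he t, fun k h => ?_⟩
  dsimp only at h
  unfold rotNodes at h
  split_ifs at h with hk
  · have := norm_rot_sub e t (nodes k)
    rw [← h, norm_nodes_sub_near hk] at this
    linarith
  · exact hz k h

theorem nodes_mem_configurations {z : ℂ} (hz : z ∈ standardPlane) :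
    (z, nodes) ∈ configurations :=
  ⟨fun _ _ h => node_injective (Complex.ofReal_injective h), hz⟩

theorem mem_standardPlane_of_norm {e : ℝ} (he : e = -1 ∨ e = 1) {z : ℂ} (hz : ‖z - e‖ = 2) :
    z ∈ standardPlane := fun k h => by
  have := norm_nodes_sub e k
  rw [nodes, ← h, hz] at this
  rcases node_sub_sq he k with h' | h' <;> rw [h'] at this <;> norm_num at this

/-! ### The relations imposed by a full turn -/

namespace Holonomy

variable {G : Type*} [Group G] (H : Holonomy configurations G)

/-- The holonomy of the motions of the first point, with the other points at `-2, 0, 2`. -/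
def fibrewise : Holonomy standardPlane G :=
  H.pullback (fun z => (z, nodes)) (by fun_prop) fun _ hz => nodes_mem_configurations hz

/-- The holonomy of the rotation of two punctures and the first point. -/
def rotInside (e : ℝ) (z : ℂ) : G := H.val fun t => (rot e t z, rotNodes e t)

/-- The holonomy of the rotation of two punctures, with the first point fixed. -/
def rotOutside (e : ℝ) (z : ℂ) : G := H.val fun t => (z, rotNodes e t)

variable {H} {e : ℝ} (he : e = -1 ∨ e = 1)

include he

/-- In the square swept out by turning the whole curve, the initial and final sides coincide because
a full turn is the identity. -/
theorem rotInside_comm {c : ℝ → ℂ} (hc : ContinuousOn c (Icc 0 1))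
    (hm : MapsTo c (Icc 0 1) standardPlane) (hn : ∀ s ∈ Icc (0 : ℝ) 1, ‖c s - e‖ < 3) :
    H.fibrewise.val c * H.rotInside e (c 1) = H.rotInside e (c 0) * H.fibrewise.val c := by
  have hc1 : ContinuousOn (fun z : ℝ × ℝ => c z.1) (Icc 0 1 ×ˢ Icc 0 1) :=
    hc.comp (by fun_prop) fun z hz => hz.1
  have h := H.square (fun s t => (rot e t (c s), rotNodes e t))
    (by
      simp only [Function.uncurry_def]
      exact (continuous_rot (by fun_prop) hc1).prodMk (continuous_rotNodes (by fun_prop)))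
    fun s hs t ht => rot_mem_configurations he t (hm hs) (hn s hs)
  simpa [fibrewise, pullback, rotInside] using h

theorem rotOutside_comm {c : ℝ → ℂ} (hc : ContinuousOn c (Icc 0 1))
    (hm : MapsTo c (Icc 0 1) standardPlane) (hn : ∀ s ∈ Icc (0 : ℝ) 1, 1 < ‖c s - e‖) :
    H.fibrewise.val c * H.rotOutside e (c 1) = H.rotOutside e (c 0) * H.fibrewise.val c := by
  have hc1 : ContinuousOn (fun z : ℝ × ℝ => c z.1) (Icc 0 1 ×ˢ Icc 0 1) :=
    hc.comp (by fun_prop) fun z hz => hz.1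
  have h := H.square (fun s t => (c s, rotNodes e t))
    (by
      simp only [Function.uncurry_def]
      exact hc1.prodMk (continuous_rotNodes (by fun_prop)))
    fun s hs t ht => mem_configurations_of_outside he t (hm hs) (hn s hs)
  simpa [fibrewise, pullback, rotOutside] using h

/-- The radius 2 lies between 1 and 3, so on this circle the point may be turned independently of
the pair: first turn the pair, then the point. -/
theorem rotInside_eq {z : ℂ} (hz : ‖z - e‖ = 2) :
    H.rotInside e z = H.rotOutside e z * H.fibrewise.val (fun t => rot e t z) := by
  have hr : ∀ s, ‖rot e s z - e‖ = 2 := fun s => by rw [norm_rot_sub, hz]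
  have h := H.square (fun s t => (rot e (s * t) z, rotNodes e s))
    (by
      simp only [Function.uncurry_def]
      exact (continuous_rot (by fun_prop) (by fun_prop)).prodMk
        (continuous_rotNodes (by fun_prop)))
    fun s hs t ht => mem_configurations_of_outside he s
      (mem_standardPlane_of_norm he (hr _)) (by rw [hr]; norm_num)
  simp only [mul_zero, zero_mul, mul_one, one_mul, rot_zero, rotNodes_zero, rotNodes_one,
    H.const _ (nodes_mem_configurations (mem_standardPlane_of_norm he hz))] at h
  exact h.symm

/-- The holonomy of the circle of radius two around `e`. -/
theorem val_circle {j : ℕ} (hj : j + 2 ≤ 3) (h0 : stripPoint j = (e - 2 : ℝ))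
    (h2 : stripPoint (j + 2) = (e + 2 : ℝ)) (H : Holonomy standardPlane G) :
    H.val (fun t => rot e t (stripPoint (j + 2))) =
      (H.pot 1 (stripPoint (j + 2)))⁻¹ * (H.jump j * (H.jump (j + 2))⁻¹) *
        H.pot 1 (stripPoint (j + 2)) := by
  have hre : ∀ t, (rot e t (stripPoint (j + 2))) =
      ⟨e + 2 * Real.cos (2 * Real.pi * t), 2 * Real.sin (2 * Real.pi * t)⟩ := by
    intro t
    have : (2 * Real.pi * t * Complex.I : ℂ) = ((2 * Real.pi * t : ℝ) : ℂ) * Complex.I := by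
      push_cast
      ring
    rw [rot, this, Complex.exp_mul_I, ← Complex.ofReal_cos, ← Complex.ofReal_sin, h2]
    apply Complex.ext <;>
      simp [-Complex.ofReal_cos, -Complex.ofReal_sin, -Complex.ofReal_mul]
  have hne : ∀ t k, (rot e t (stripPoint (j + 2))).re = node k →
      (rot e t (stripPoint (j + 2))).im ≠ 0 := by
    intro t k hk him
    refine mem_standardPlane_of_norm he (z := rot e t (stripPoint (j + 2))) ?_ k
      (Complex.ext (by simpa using hk) (by simpa using him))
    rw [norm_rot_sub, h2, ← Complex.ofReal_sub, add_sub_cancel_left, Complex.norm_real]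
    norm_num
  have hhalf : rot e (1 / 2) (stripPoint (j + 2)) = stripPoint j := by
    rw [hre, h0, show 2 * Real.pi * (1 / 2) = Real.pi by ring, Real.cos_pi, Real.sin_pi]
    apply Complex.ext <;> simp
    ring
  rw [val_eq_of_halves mul_self_one (by fun_prop), hhalf]
  · simp only [rot_zero, rot_one]
    rw [pot_eq_jump_mul (by omega) (stripPoint_mem j),
      pot_eq_jump_mul (by omega) (stripPoint_mem (j + 2))]
    group
  · intro t ht k hk
    have h := hne t k hk
    dsimp only
    rw [hre] at h ⊢
    dsimp only at h ⊢
    have := Real.sin_nonneg_of_nonneg_of_le_pi (x := 2 * Real.pi * t)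
      (by have := ht.1; positivity) (by nlinarith [ht.2, Real.pi_pos])
    rw [one_mul]
    exact lt_of_le_of_ne (by linarith) h.symm
  · intro t ht k hk
    have h := hne t k hk
    dsimp only
    rw [hre] at h ⊢
    dsimp only at h ⊢
    have h1 := Real.sin_nonneg_of_nonneg_of_le_pi (x := 2 * Real.pi * t - Real.pi)
      (by nlinarith [ht.1, Real.pi_pos]) (by nlinarith [ht.2, Real.pi_pos])
    rw [Real.sin_sub_pi] at h1
    have := lt_of_le_of_ne (show 2 * Real.sin (2 * Real.pi * t) ≤ 0 by linarith) h
    linarith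

omit he

/-- Transport of a conjugacy datum along the segment in a piece of a cut plane. -/
theorem pot_conj_of_seg {H : Holonomy standardPlane G} {ς : ℝ} (hς : ς * ς = 1) {C : Set ℂ}
    (hC : IsPiece ς C) {x y : ℂ} (hx : x ∈ C) (hy : y ∈ C) {Q : ℂ → G}
    (h : H.seg x y * Q y = Q x * H.seg x y) :
    H.pot ς x * Q x * (H.pot ς x)⁻¹ = H.pot ς y * Q y * (H.pot ς y)⁻¹ := by
  have h1 : Q x = H.seg x y * Q y * (H.seg x y)⁻¹ := eq_mul_inv_of_mul_eq h.symm
  rw [h1, seg_eq_pot hς hC hx hy]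
  group

/-- If `Q` is natural for the segments in a region that contains the vertical segments at two strip
points and the horizontal segments between them, then the corresponding conjugate of `Q` commutes
with the quotient of the jumps. -/
theorem commute_jump {H : Holonomy standardPlane G} {Q : ℂ → G} {R : Set ℂ}
    (hQ : ∀ x y : ℂ, (∀ s ∈ Icc (0 : ℝ) 1, x + s • (y - x) ∈ standardPlane) →
      (∀ s ∈ Icc (0 : ℝ) 1, x + s • (y - x) ∈ R) → H.seg x y * Q y = Q x * H.seg x y)
    {j k : ℕ} (hj : j ≤ 3) (hk : k ≤ 3)
    (hRj : ∀ b : ℝ, |b| ≤ 2 → (⟨2 * j - 3, b⟩ : ℂ) ∈ R)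
    (hRk : ∀ b : ℝ, |b| ≤ 2 → (⟨2 * k - 3, b⟩ : ℂ) ∈ R)
    (hRjk : ∀ b : ℝ, |b| = 2 → ∀ s ∈ Icc (0 : ℝ) 1,
      (⟨2 * j - 3 + s * (2 * k - 2 * j), b⟩ : ℂ) ∈ R) :
    Commute (H.pot 1 (stripPoint j) * Q (stripPoint j) * (H.pot 1 (stripPoint j))⁻¹)
      (H.jump j * (H.jump k)⁻¹) := by
  -- Conjugating `Q` by the potential gives a quantity that is constant along admissible segments,
  -- here the vertical one from the real axis to height `2 * ς`.
  have column : ∀ {l : ℕ}, l ≤ 3 → (∀ b : ℝ, |b| ≤ 2 → (⟨2 * l - 3, b⟩ : ℂ) ∈ R) →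
      ∀ {ς : ℝ}, ς * ς = 1 →
      H.pot ς (stripPoint l) * Q (stripPoint l) * (H.pot ς (stripPoint l))⁻¹ =
        H.pot ς ⟨2 * l - 3, 2 * ς⟩ * Q ⟨2 * l - 3, 2 * ς⟩ * (H.pot ς ⟨2 * l - 3, 2 * ς⟩)⁻¹ := by
    intro l hl hRl ς hς
    have hC : IsPiece ς (strip l) := Or.inr ⟨l, hl, rfl⟩
    have hy : (⟨2 * l - 3, 2 * ς⟩ : ℂ) ∈ strip l := stripPoint_mem l
    refine pot_conj_of_seg hς hC (stripPoint_mem l) hy (hQ _ _ (fun s hs => hC.subset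
      (seg_mem hC.convex (stripPoint_mem l) hy hs)) fun s hs => ?_)
    convert hRl (s * (2 * ς)) ?_ using 1
    · apply Complex.ext <;> simp [stripPoint]
    · have : |ς| = 1 := by rcases mul_self_eq_one_iff.1 hς with rfl | rfl <;> simp
      rw [abs_mul, abs_mul, this, abs_of_nonneg hs.1, abs_two]
      linarith [hs.2]
  have agree : ∀ {ς : ℝ}, ς * ς = 1 →
      H.pot ς (stripPoint j) * Q (stripPoint j) * (H.pot ς (stripPoint j))⁻¹ =
        H.pot ς (stripPoint k) * Q (stripPoint k) * (H.pot ς (stripPoint k))⁻¹ := by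
    intro ς hς
    rw [column hj hRj hς, column hk hRk hς]
    have hC : IsPiece ς (halfPlane ς) := Or.inl rfl
    have hmem : ∀ a : ℝ, (⟨a, 2 * ς⟩ : ℂ) ∈ halfPlane ς := fun a => by
      simp only [halfPlane, mem_ofPred_eq]
      linarith
    refine pot_conj_of_seg hς hC (hmem _) (hmem _) (hQ _ _ (fun s hs => hC.subset
      (seg_mem hC.convex (hmem _) (hmem _) hs)) fun s hs => ?_)
    convert hRjk (2 * ς) ?_ s hs using 1
    · apply Complex.ext <;> simp
    · rcases mul_self_eq_one_iff.1 hς with rfl | rfl <;> simp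
  -- Comparing columns `j` and `k` above and below the axis gives two equations. The jumps relate
  -- them, and together they express commutation with the rectangle through both columns.
  have h1 := agree mul_self_one
  have h2 := agree mul_self_neg_one
  have split : ∀ {l : ℕ}, l ≤ 3 →
      H.pot 1 (stripPoint l) * Q (stripPoint l) * (H.pot 1 (stripPoint l))⁻¹ = H.jump l *
        (H.pot (-1) (stripPoint l) * Q (stripPoint l) * (H.pot (-1) (stripPoint l))⁻¹) *
        (H.jump l)⁻¹ := fun {l} hl => by
    rw [pot_eq_jump_mul hl (stripPoint_mem l)]
    group
  rw [split hj, split hk, ← h2] at h1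
  rw [split hj]
  generalize H.pot (-1) (stripPoint j) * Q (stripPoint j) * (H.pot (-1) (stripPoint j))⁻¹ = n at h1
  rw [Commute, SemiconjBy]
  nth_rw 2 [h1]
  group

/-- The relations that the rotation about `e` imposes on the holonomy. -/
theorem exists_rotation_relations (H : Holonomy configurations G) {m : ℕ} {e : ℝ}
    (hm : (m = 0 ∧ e = -1) ∨ (m = 1 ∧ e = 1)) :
    ∃ M : G,
      Commute M (H.fibrewise.jump m * (H.fibrewise.jump (m + 2))⁻¹) ∧
      (∀ j ≤ 3, j ≠ m + 1 → Commute M (H.fibrewise.jump (m + 2) * (H.fibrewise.jump j)⁻¹)) ∧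
      (∀ j, m ≤ j → j ≤ m + 2 → Commute (M * (H.fibrewise.jump m * (H.fibrewise.jump (m + 2))⁻¹))
        (H.fibrewise.jump (m + 2) * (H.fibrewise.jump j)⁻¹)) := by
  have he : e = -1 ∨ e = 1 := hm.imp And.right And.right
  have hem : e = 2 * m - 1 := by rcases hm with ⟨rfl, rfl⟩ | ⟨rfl, rfl⟩ <;> norm_num
  have hm1 : m ≤ 1 := by omega
  have hseg : ∀ x y : ℂ, ContinuousOn (fun s : ℝ => x + s • (y - x)) (Icc 0 1) := fun x y => by
    fun_prop
  have hin : ∀ x y : ℂ, (∀ s ∈ Icc (0 : ℝ) 1, x + s • (y - x) ∈ standardPlane) →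
      (∀ s ∈ Icc (0 : ℝ) 1, x + s • (y - x) ∈ {z : ℂ | ‖z - e‖ < 3}) →
      H.fibrewise.seg x y * H.rotInside e y = H.rotInside e x * H.fibrewise.seg x y := by
    intro x y h1 h2
    have h := rotInside_comm (H := H) he (hseg x y) h1 h2
    simp only [zero_smul, add_zero, one_smul, add_sub_cancel] at h
    exact h
  have hout : ∀ x y : ℂ, (∀ s ∈ Icc (0 : ℝ) 1, x + s • (y - x) ∈ standardPlane) →
      (∀ s ∈ Icc (0 : ℝ) 1, x + s • (y - x) ∈ {z : ℂ | 1 < ‖z - e‖}) →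
      H.fibrewise.seg x y * H.rotOutside e y = H.rotOutside e x * H.fibrewise.seg x y := by
    intro x y h1 h2
    have h := rotOutside_comm (H := H) he (hseg x y) h1 h2
    simp only [zero_smul, add_zero, one_smul, add_sub_cancel] at h
    exact h
  have hnorm : ∀ a b : ℝ, ‖(⟨a, b⟩ : ℂ) - e‖ ^ 2 = (a - e) ^ 2 + b ^ 2 := fun a b => by
    rw [Complex.sq_norm, Complex.normSq_apply]
    simp
    ring
  have outer : ∀ j ≤ 3, j ≠ m + 1 → Commute (H.fibrewise.pot 1 (stripPoint (m + 2)) *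
      H.rotOutside e (stripPoint (m + 2)) * (H.fibrewise.pot 1 (stripPoint (m + 2)))⁻¹)
      (H.fibrewise.jump (m + 2) * (H.fibrewise.jump j)⁻¹) := by
    intro j hj hjm
    -- Column `m + 1` passes through the centre `e`; all other columns have distance at least 2 from
    -- it.
    have hcol : ∀ l : ℕ, l ≠ m + 1 → ∀ b : ℝ, |b| ≤ 2 →
        (⟨2 * l - 3, b⟩ : ℂ) ∈ {z : ℂ | 1 < ‖z - e‖} := by
      intro l hl b _
      have hsq : (1 : ℝ) ≤ ((l : ℝ) - m - 1) ^ 2 := by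
        have : (1 : ℤ) ≤ ((l : ℤ) - m - 1) ^ 2 := by
          have : (l : ℤ) - m - 1 ≠ 0 := by omega
          have := sq_pos_of_ne_zero this
          omega
        exact_mod_cast this
      have h4 : (2 * (l : ℝ) - 3 - e) ^ 2 = 4 * ((l : ℝ) - m - 1) ^ 2 := by
        rw [hem]
        ring
      have := hnorm (2 * l - 3) b
      rw [mem_ofPred_eq]
      nlinarith [sq_nonneg b, norm_nonneg ((⟨2 * l - 3, b⟩ : ℂ) - e)]
    refine commute_jump hout (by omega) hj (hcol _ (by omega)) (hcol _ hjm) ?_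
    intro b hb s _
    rw [mem_ofPred_eq]
    have := hnorm (2 * ((m + 2 : ℕ) : ℝ) - 3 + s * (2 * j - 2 * ((m + 2 : ℕ) : ℝ))) b
    rw [← sq_abs b, hb] at this
    nlinarith [sq_nonneg (2 * ((m + 2 : ℕ) : ℝ) - 3 + s * (2 * j - 2 * ((m + 2 : ℕ) : ℝ)) - e),
      norm_nonneg ((⟨2 * ((m + 2 : ℕ) : ℝ) - 3 + s * (2 * j - 2 * ((m + 2 : ℕ) : ℝ)), b⟩ : ℂ) - e)]
  have inner : ∀ j, m ≤ j → j ≤ m + 2 → Commute (H.fibrewise.pot 1 (stripPoint (m + 2)) *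
      H.rotInside e (stripPoint (m + 2)) * (H.fibrewise.pot 1 (stripPoint (m + 2)))⁻¹)
      (H.fibrewise.jump (m + 2) * (H.fibrewise.jump j)⁻¹) := by
    intro j hj hjm
    -- The corners of this box are at distance √8 < 3 from `e`.
    have hbox : ∀ a b : ℝ, |a - e| ≤ 2 → |b| ≤ 2 → (⟨a, b⟩ : ℂ) ∈ {z : ℂ | ‖z - e‖ < 3} := by
      intro a b ha hb
      have := hnorm a b
      rw [mem_ofPred_eq]
      have h1 := sq_le_sq' (abs_le.1 ha).1 (abs_le.1 ha).2
      have h2 := sq_le_sq' (abs_le.1 hb).1 (abs_le.1 hb).2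
      nlinarith [norm_nonneg ((⟨a, b⟩ : ℂ) - e)]
    have hcol : ∀ l : ℕ, m ≤ l → l ≤ m + 2 → |(2 * l - 3 : ℝ) - e| ≤ 2 := by
      intro l h1 h2
      have h1 : (m : ℝ) ≤ l := by exact_mod_cast h1
      have h2 : (l : ℝ) ≤ m + 2 := by exact_mod_cast h2
      rw [abs_le]
      constructor <;> linarith
    refine commute_jump hin (by omega) (by omega) (fun b => hbox _ b (hcol _ (by omega) le_rfl))
      (fun b => hbox _ b (hcol _ hj hjm)) ?_
    intro b hb s hs
    refine hbox _ b ?_ hb.le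
    have h1 := abs_le.1 (hcol (m + 2) (by omega) le_rfl)
    have h2 := abs_le.1 (hcol j hj hjm)
    rw [abs_le]
    constructor <;> nlinarith [hs.1, hs.2]
  have h0 : stripPoint m = (e - 2 : ℝ) := by
    rw [stripPoint, hem]
    congr 1
    ring
  have h2 : stripPoint (m + 2) = (e + 2 : ℝ) := by
    rw [stripPoint, hem]
    push_cast
    ring
  have hq : ‖stripPoint (m + 2) - e‖ = 2 := by
    rw [h2, ← Complex.ofReal_sub, add_sub_cancel_left, Complex.norm_real]
    norm_num
  have key : H.fibrewise.pot 1 (stripPoint (m + 2)) * H.rotInside e (stripPoint (m + 2)) *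
      (H.fibrewise.pot 1 (stripPoint (m + 2)))⁻¹ =
      H.fibrewise.pot 1 (stripPoint (m + 2)) * H.rotOutside e (stripPoint (m + 2)) *
      (H.fibrewise.pot 1 (stripPoint (m + 2)))⁻¹ *
      (H.fibrewise.jump m * (H.fibrewise.jump (m + 2))⁻¹) := by
    rw [rotInside_eq he hq, val_circle he (by omega) h0 h2]
    group
  -- The witness, determined by `outer`, is the conjugate of `rotOutside` by the potential.
  refine ⟨_, ?_, outer, ?_⟩
  · have := (outer m (by omega) (by omega)).inv_right
    rwa [mul_inv_rev, inv_inv] at this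
  · rw [← key]
    exact inner

end Holonomy

/-! ### The relations in the symmetric group -/

/-- If `a ≠ b`, then `a * b` is a 3-cycle, whose centralizer meets that of the transposition `c`
trivially. So `M = 1`, and a 3-cycle would commute with `a`. -/
theorem perm_fin_three_relations : ∀ a b c M : Equiv.Perm (Fin 3), Equiv.Perm.sign a = -1 →
    Equiv.Perm.sign b = -1 → Equiv.Perm.sign c = -1 → M * (a * b) = a * b * M → M * c = c * M →
    M * (a * b) * a = a * (M * (a * b)) → a = b := by
  decide +kernel

/-- A representation in `S₃` for which the loops around the three finite punctures go to
transpositions has the same transposition for all of them. -/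
theorem Holonomy.exists_potential_of_sign (H : Holonomy configurations (Equiv.Perm (Fin 3)))
    (hsign : ∀ j < 3, Equiv.Perm.sign (H.fibrewise.jump j * (H.fibrewise.jump (j + 1))⁻¹) = -1) :
    ∃ (A : ℂ → Equiv.Perm (Fin 3)) (τ : Equiv.Perm (Fin 3)), ∀ c : ℝ → ℂ,
      ContinuousOn c (Icc 0 1) → MapsTo c (Icc 0 1) standardPlane →
      A (c 0) * H.fibrewise.val c * (A (c 1))⁻¹ ∈ Subgroup.zpowers τ := by
  have hpot := fun S => exists_potential (H := H.fibrewise) S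
  have hr0 := H.exists_rotation_relations (m := 0) (e := -1) (by simp)
  have hr1 := H.exists_rotation_relations (m := 1) (e := 1) (by simp)
  generalize H.fibrewise.jump = J at hsign hpot hr0 hr1
  have ha := hsign 0 (by norm_num)
  have hb := hsign 1 (by norm_num)
  have hc := hsign 2 (by norm_num)
  norm_num only at ha hb hc
  have hab : J 0 * (J 1)⁻¹ = J 1 * (J 2)⁻¹ := by
    obtain ⟨M, h1, h2, h3⟩ := hr0
    norm_num only at h1 h2 h3
    refine perm_fin_three_relations _ _ (J 2 * (J 3)⁻¹) M ha hb hc ?_ (h2 3 le_rfl (by norm_num)) ?_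
    · convert h1.eq using 2 <;> group
    · convert (((h3 0 le_rfl (by norm_num)).inv_right).mul_right
        (h3 1 (by norm_num) (by norm_num))).eq using 2 <;> group
  have hbc : J 1 * (J 2)⁻¹ = J 2 * (J 3)⁻¹ := by
    obtain ⟨M, h1, h2, h3⟩ := hr1
    norm_num only at h1 h2 h3
    -- Now the second and third punctures turn, and the first plays the part of the outer one.
    refine perm_fin_three_relations _ _ (J 0 * (J 1)⁻¹) M hb hc ha ?_ ?_ ?_
    · convert h1.eq using 2 <;> group
    · convert (((h2 0 (by norm_num) (by norm_num)).inv_right).mul_right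
        (h2 1 (by norm_num) (by norm_num))).eq using 2 <;> group
    · convert (((h3 1 le_rfl (by norm_num)).inv_right).mul_right
        (h3 2 (by norm_num) (by norm_num))).eq using 2 <;> group
  obtain ⟨A, hA⟩ := hpot (Subgroup.zpowers (J 0 * (J 1)⁻¹)) (by
      have h0 := Subgroup.mem_zpowers (J 0 * (J 1)⁻¹)
      have h1 : J 1 * (J 2)⁻¹ ∈ Subgroup.zpowers (J 0 * (J 1)⁻¹) := hab ▸ h0
      have h2 : J 2 * (J 3)⁻¹ ∈ Subgroup.zpowers (J 0 * (J 1)⁻¹) := hbc ▸ h1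
      intro j hj
      interval_cases j
      · rw [mul_inv_cancel]
        exact one_mem _
      · convert inv_mem h0 using 1
        group
      · convert inv_mem (mul_mem h0 h1) using 1
        group
      · convert inv_mem (mul_mem (mul_mem h0 h1) h2) using 1
        group)
  exact ⟨A, _, hA⟩

/-! ### Small circles and straightening homeomorphisms -/

/-- The loop around `p` that starts at `p + w`. -/
def circleAt (p w : ℂ) (t : ℝ) : ℂ := p + w * Complex.exp (2 * Real.pi * t * Complex.I)

@[fun_prop]
theorem continuous_circleAt (p w : ℂ) : Continuous (circleAt p w) := by
  unfold circleAt
  fun_prop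

/-- Concentric circles have conjugate holonomy. -/
theorem Holonomy.isConj_circle {E G : Type*} [TopologicalSpace E] [Group G] {U : Set E}
    (H : Holonomy U G) {h : ℂ → E} (hh : Continuous h) {p w w' : ℂ} (hw : w ≠ 0) (hw' : w' ≠ 0)
    (hle : ‖w'‖ ≤ ‖w‖) (hU : ∀ u : ℂ, u ≠ 0 → ‖u‖ ≤ ‖w‖ → h (p + u) ∈ U) :
    IsConj (H.val fun t => h (circleAt p w t)) (H.val fun t => h (circleAt p w' t)) := by
  -- Interpolating the logarithms of the two radius vectors avoids `0` and never exceeds the larger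
  -- norm.
  have hc := H.isConj_of_square (fun s t =>
    h (circleAt p (Complex.exp (Complex.log w + t * (Complex.log w' - Complex.log w))) s))
    (by
      simp only [Function.uncurry_def, circleAt]
      fun_prop)
    (fun s _ t ht => by
      refine hU _ (mul_ne_zero (Complex.exp_ne_zero _) (Complex.exp_ne_zero _)) ?_
      have hs : (2 * Real.pi * s * Complex.I : ℂ) = ((2 * Real.pi * s : ℝ) : ℂ) * Complex.I := by
        push_cast
        ring
      rw [norm_mul, hs, Complex.norm_exp_ofReal_mul_I, mul_one, Complex.norm_exp,
        ← Real.le_log_iff_exp_le (norm_pos_iff.2 hw)]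
      simp only [Complex.add_re, Complex.re_ofReal_mul, Complex.sub_re, Complex.log_re]
      have := Real.log_le_log (norm_pos_iff.2 hw') hle
      nlinarith [ht.1])
    fun t => by simp [circleAt]
  simpa [Complex.exp_log hw, Complex.exp_log hw'] using hc

/-- A homeomorphism of the line that takes three given points to the standard ones. -/
theorem exists_real_straightening {x : Fin 3 → ℝ} (hx : StrictMono x) :
    ∃ φ ψ : ℝ → ℝ, Continuous φ ∧ Continuous ψ ∧ StrictMono φ ∧ (∀ t, ψ (φ t) = t) ∧
      (∀ u, φ (ψ u) = u) ∧ ∀ k, φ (node k) = x k := by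
  have h01 : x 0 < x 1 := hx (by decide)
  have h12 : x 1 < x 2 := hx (by decide)
  obtain ⟨A, hA, hA'⟩ : ∃ A, 0 < A ∧ x 2 = x 1 + A * 2 := ⟨(x 2 - x 1) / 2, by linarith, by ring⟩
  obtain ⟨B, hB, hB'⟩ : ∃ B, 0 < B ∧ x 0 = x 1 + B * (-2) :=
    ⟨(x 1 - x 0) / 2, by linarith, by ring⟩
  refine ⟨fun t => x 1 + A * max t 0 + B * min t 0,
    fun u => max (u - x 1) 0 / A + min (u - x 1) 0 / B, by fun_prop, by fun_prop, ?_, ?_, ?_, ?_⟩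
  · intro s t hst
    have h1 : max s 0 ≤ max t 0 := max_le_max hst.le le_rfl
    have h2 : min s 0 ≤ min t 0 := min_le_min hst.le le_rfl
    have h3 : s = max s 0 + min s 0 := by rw [max_add_min, add_zero]
    have h4 : t = max t 0 + min t 0 := by rw [max_add_min, add_zero]
    rcases h1.lt_or_eq with h | h
    · simp only
      nlinarith [mul_lt_mul_of_pos_left h hA, mul_le_mul_of_nonneg_left h2 hB.le]
    · have h' : min s 0 < min t 0 := by linarith
      simp only
      nlinarith [mul_le_mul_of_nonneg_left h1 hA.le, mul_lt_mul_of_pos_left h' hB]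
  · intro t
    rcases le_total 0 t with h | h
    · have : 0 ≤ A * t := by positivity
      simp only [max_eq_left h, min_eq_right h, mul_zero, add_zero, add_sub_cancel_left,
        max_eq_left this, min_eq_right this, zero_div]
      field_simp
    · have : B * t ≤ 0 := mul_nonpos_of_nonneg_of_nonpos hB.le h
      simp only [max_eq_right h, min_eq_left h, mul_zero, add_zero, add_sub_cancel_left,
        max_eq_right this, min_eq_left this, zero_div, zero_add]
      field_simp
  · intro u
    rcases le_total 0 (u - x 1) with h | h
    · have : 0 ≤ (u - x 1) / A := by positivity
      simp only [max_eq_left h, min_eq_right h, mul_zero, add_zero,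
        max_eq_left this, min_eq_right this, zero_div]
      field_simp
      ring
    · have : (u - x 1) / B ≤ 0 := div_nonpos_of_nonpos_of_nonneg h hB.le
      simp only [max_eq_right h, min_eq_left h, mul_zero, add_zero,
        max_eq_right this, min_eq_left this, zero_div, zero_add]
      field_simp
      ring
  · intro k
    obtain rfl | rfl | rfl : k = 0 ∨ k = 1 ∨ k = 2 := by
      revert k
      decide
    all_goals norm_num [node, hA', hB']

/-- A homeomorphism of the plane that preserves the vertical direction and takes three given points
to the standard ones. -/
theorem exists_plane_straightening {P : Fin 3 → ℂ} (hP : StrictMono fun k => (P k).re) :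
    ∃ g h : ℂ → ℂ, Continuous g ∧ Continuous h ∧ (∀ z, g (h z) = z) ∧ (∀ z, h (g z) = z) ∧
      (∀ k, g (nodes k) = P k) ∧ ∃ δ : ℝ, 0 < δ ∧ ∀ k : Fin 3, ∀ ε, 0 < ε → ε < δ →
        h (circleAt (P k) (-ε : ℝ) 0) ∈ strip k ∧
        h (circleAt (P k) (-ε : ℝ) (1 / 2)) ∈ strip (k + 1) ∧
        MapsTo (fun t => h (circleAt (P k) (-ε : ℝ) t)) (Icc 0 (1 / 2)) (cutPlane (-1)) ∧
        MapsTo (fun t => h (circleAt (P k) (-ε : ℝ) t)) (Icc (1 / 2) 1) (cutPlane 1) := by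
  obtain ⟨φ, ψ, hφ, hψ, hmono, hψφ, hφψ, hnode⟩ := exists_real_straightening hP
  obtain ⟨R, hR, hRnode⟩ : ∃ R : ℝ → ℝ, Continuous R ∧ ∀ k, R (node k) = (P k).im := by
    -- The quadratic polynomial interpolating the imaginary parts at -2, 0, 2; it is used as a
    -- vertical shear.
    refine ⟨fun t => (P 1).im + ((P 2).im - (P 0).im) / 4 * t +
      ((P 0).im + (P 2).im - 2 * (P 1).im) / 8 * t ^ 2, by fun_prop, fun k => ?_⟩
    fin_cases k <;> simp [node] <;> ring
  have hmk : ∀ {f₁ f₂ : ℂ → ℝ}, Continuous f₁ → Continuous f₂ →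
      Continuous fun z => (⟨f₁ z, f₂ z⟩ : ℂ) := fun h1 h2 =>
    Complex.equivRealProdCLM.symm.continuous.comp (h1.prodMk h2)
  let g : ℂ → ℂ := fun z => ⟨φ z.re, z.im + R z.re⟩
  let h : ℂ → ℂ := fun z => ⟨ψ z.re, z.im - R (ψ z.re)⟩
  refine ⟨g, h, hmk (by fun_prop) (by fun_prop), hmk (by fun_prop) (by fun_prop), fun z => ?_,
    fun z => ?_, fun k => ?_, ?_⟩
  · simp [g, h, hφψ]
  · simp [g, h, hψφ]
  · apply Complex.ext <;> simp [g, nodes, hnode, hRnode]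
  -- A circle of radius less than `δ` about one point misses the vertical lines through the other
  -- two. Starting at its leftmost point, it passes below the centre and returns above.
  obtain ⟨δ, hδ, hgap⟩ : ∃ δ : ℝ, 0 < δ ∧ ∀ k l, k < l → (P k).re + δ ≤ (P l).re := by
    have h01 : (P 0).re < (P 1).re := hP (by decide)
    have h12 : (P 1).re < (P 2).re := hP (by decide)
    refine ⟨min ((P 1).re - (P 0).re) ((P 2).re - (P 1).re), by simp [h01, h12], ?_⟩
    have h1 := min_le_left ((P 1).re - (P 0).re) ((P 2).re - (P 1).re)
    have h2 := min_le_right ((P 1).re - (P 0).re) ((P 2).re - (P 1).re)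
    intro k l hkl
    fin_cases k <;> fin_cases l <;> simp at hkl ⊢ <;> linarith
  refine ⟨δ, hδ, fun k ε hε hεδ => ?_⟩
  have hcirc : ∀ t, circleAt (P k) (-ε : ℝ) t =
      ⟨(P k).re - ε * Real.cos (2 * Real.pi * t), (P k).im - ε * Real.sin (2 * Real.pi * t)⟩ := by
    intro t
    have : (2 * Real.pi * t * Complex.I : ℂ) = ((2 * Real.pi * t : ℝ) : ℂ) * Complex.I := by
      push_cast
      ring
    rw [circleAt, this, Complex.exp_mul_I, ← Complex.ofReal_cos, ← Complex.ofReal_sin]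
    apply Complex.ext <;>
      simp [-Complex.ofReal_cos, -Complex.ofReal_sin, -Complex.ofReal_mul, sub_eq_add_neg]
  have hlt : ∀ (l : Fin 3) (u : ℝ), (P l).re < u → node l < ψ u := fun l u hu =>
    hmono.lt_iff_lt.1 (by rwa [hnode, hφψ])
  have hgt : ∀ (l : Fin 3) (u : ℝ), u < (P l).re → ψ u < node l := fun l u hu =>
    hmono.lt_iff_lt.1 (by rwa [hnode, hφψ])
  have hline : ∀ t l, (h (circleAt (P k) (-ε : ℝ) t)).re = node l →
      Real.cos (2 * Real.pi * t) = 0 ∧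
        (h (circleAt (P k) (-ε : ℝ) t)).im = -ε * Real.sin (2 * Real.pi * t) := by
    intro t l hl
    have h1 : (P k).re - ε * Real.cos (2 * Real.pi * t) = (P l).re := by
      rw [← hnode l, ← hl, hcirc]
      exact (hφψ _).symm
    have hc := abs_le.1 (Real.abs_cos_le_one (2 * Real.pi * t))
    have hkl : k = l := by
      rcases lt_trichotomy k l with hkl | hkl | hkl
      · have := hgap k l hkl
        nlinarith
      · exact hkl
      · have := hgap l k hkl
        nlinarith
    subst hkl
    refine ⟨by simpa [hε.ne'] using h1, ?_⟩
    have h2 : ψ ((P k).re - ε * Real.cos (2 * Real.pi * t)) = node k := by rw [h1, ← hnode, hψφ]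
    rw [hcirc]
    simp only [h, h2, hRnode]
    ring
  refine ⟨?_, ?_, ?_, ?_⟩
  · intro l
    rw [hcirc]
    simp only [h, mul_zero, Real.cos_zero, mul_one]
    refine ⟨fun hl => hlt _ _ ?_, fun hl => hgt _ _ ?_⟩
    · have := hgap l k hl
      linarith
    · have := hP.monotone (Fin.le_def.2 hl)
      linarith
  · intro l
    rw [hcirc, show 2 * Real.pi * (1 / 2) = Real.pi by ring]
    simp only [h, Real.cos_pi]
    refine ⟨fun hl => hlt _ _ ?_, fun hl => hgt _ _ ?_⟩
    · have := hP.monotone (Fin.le_def.2 (Nat.lt_succ_iff.1 hl))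
      linarith
    · have := hgap k l hl
      linarith
  · intro t ht l hl
    obtain ⟨hcos, him⟩ := hline t l hl
    rw [him]
    have h1 := Real.sin_nonneg_of_nonneg_of_le_pi (x := 2 * Real.pi * t)
      (by have := ht.1; positivity) (by nlinarith [ht.2, Real.pi_pos])
    have h2 := Real.sin_sq_add_cos_sq (2 * Real.pi * t)
    rw [hcos] at h2
    have : 0 < Real.sin (2 * Real.pi * t) := lt_of_le_of_ne h1 fun h0 => by simp [← h0] at h2
    nlinarith
  · intro t ht l hl
    obtain ⟨hcos, him⟩ := hline t l hl
    rw [him]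
    have h1 := Real.sin_nonneg_of_nonneg_of_le_pi (x := 2 * Real.pi * t - Real.pi)
      (by nlinarith [ht.1, Real.pi_pos]) (by nlinarith [ht.2, Real.pi_pos])
    rw [Real.sin_sub_pi] at h1
    have h2 := Real.sin_sq_add_cos_sq (2 * Real.pi * t)
    rw [hcos] at h2
    have : Real.sin (2 * Real.pi * t) < 0 :=
      lt_of_le_of_ne (by linarith) fun h0 => by simp [h0] at h2
    nlinarith

/-- Any three distinct points of the plane can be moved to the standard ones by a homeomorphism that
is compatible with the orientation of small circles around them. -/
theorem exists_straightening {p : Fin 3 → ℂ} (hp : Function.Injective p) :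
    ∃ (τ : Equiv.Perm (Fin 3)) (g h : ℂ → ℂ), Continuous g ∧ Continuous h ∧ (∀ z, g (h z) = z) ∧
      (∀ z, h (g z) = z) ∧ (∀ k, g (nodes k) = p (τ k)) ∧ ∀ (k : Fin 3) (r : ℝ), 0 < r →
        ∃ w : ℂ, w ≠ 0 ∧ ‖w‖ ≤ r ∧
        h (circleAt (p (τ k)) w 0) ∈ strip k ∧ h (circleAt (p (τ k)) w (1 / 2)) ∈ strip (k + 1) ∧
        MapsTo (fun t => h (circleAt (p (τ k)) w t)) (Icc 0 (1 / 2)) (cutPlane (-1)) ∧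
        MapsTo (fun t => h (circleAt (p (τ k)) w t)) (Icc (1 / 2) 1) (cutPlane 1) := by
  -- Multiplication by `1 + iη` makes the real parts distinct unless `η` is one of finitely many
  -- ratios. Horizontal differences, for which the ratio is a junk value, are treated separately.
  obtain ⟨η, hη⟩ := (Set.finite_range fun q : Fin 3 × Fin 3 =>
    (p q.1 - p q.2).re / (p q.1 - p q.2).im).exists_notMem
  set μ : ℂ := ⟨1, η⟩
  have hμ : μ ≠ 0 := fun h0 => by simpa [μ] using congrArg Complex.re h0
  have hinj : Function.Injective fun k => (μ * p k).re := by
    intro a b hab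
    have h0 : (p a - p b).re - η * (p a - p b).im = 0 := by
      simp only [μ, Complex.mul_re, one_mul, Complex.sub_re, Complex.sub_im] at hab ⊢
      linarith
    by_contra hne
    by_cases him : (p a - p b).im = 0
    · rw [him, mul_zero, sub_zero] at h0
      exact hne (hp (sub_eq_zero.1 (Complex.ext h0 him)))
    · refine hη ⟨(a, b), ?_⟩
      simp only
      field_simp
      linarith
  set τ := Tuple.sort fun k => (μ * p k).re
  have hmono : StrictMono fun k => (μ * p (τ k)).re :=
    (Tuple.monotone_sort fun k => (μ * p k).re).strictMono_of_injective
      (hinj.comp τ.injective)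
  obtain ⟨g, h, hg, hh, hgh, hhg, hnode, δ, hδ, hcirc⟩ := exists_plane_straightening hmono
  refine ⟨τ, fun z => μ⁻¹ * g z, fun z => h (μ * z), by fun_prop, by fun_prop, fun z => ?_,
    fun z => ?_, fun k => ?_, fun k r hr => ?_⟩
  · simp [hgh, hμ]
  · simp [hhg, hμ]
  · simp [hnode, hμ]
  have hε : 0 < min (δ / 2) (r * ‖μ‖) := lt_min (by linarith) (mul_pos hr (norm_pos_iff.2 hμ))
  set ε := min (δ / 2) (r * ‖μ‖)
  have hscale : ∀ t, μ * circleAt (p (τ k)) (μ⁻¹ * (-ε : ℝ)) t =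
      circleAt (μ * p (τ k)) (-ε : ℝ) t := fun t => by
    simp only [circleAt]
    field_simp
  refine ⟨μ⁻¹ * (-ε : ℝ), mul_ne_zero (inv_ne_zero hμ) (by simpa using hε.ne'), ?_, ?_⟩
  · rw [norm_mul, norm_inv, Complex.norm_real, norm_neg, Real.norm_of_nonneg hε.le,
      inv_mul_le_iff₀ (norm_pos_iff.2 hμ), mul_comm]
    exact min_le_right _ _
  · simp only [hscale]
    exact hcirc k ε hε (lt_of_le_of_lt (min_le_left _ _) (by linarith))

/-! ### From plane configurations to `M_{0,5}` -/

/-- The coordinate of a finite point of the Riemann sphere. -/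
def finitePart : P1 → ℂ
  | OnePoint.some z => z
  | OnePoint.infty => 0

theorem coe_finitePart {y : P1} (hy : y ≠ OnePoint.infty) : (finitePart y : P1) = y := by
  induction y using OnePoint.rec with
  | infty => exact absurd rfl hy
  | coe z => rfl

theorem continuousOn_finitePart : ContinuousOn finitePart {OnePoint.infty}ᶜ := by
  intro y hy
  refine ContinuousAt.continuousWithinAt ?_
  induction y using OnePoint.rec with
  | infty => exact absurd rfl hy
  | coe z => exact OnePoint.continuousAt_coe.2 continuousAt_id

/-- The point of `M_{0,5}` determined by a configuration in the plane: `τ` says which of the points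
of the configuration is to be taken to the second entry, to `0` and to `1`. -/
def normalize (τ : Equiv.Perm (Fin 3)) (g : ℂ → ℂ) (c : ℂ × (Fin 3 → ℂ)) : Fin 5 → P1 :=
  ![(((g c.1 - g (c.2 (τ.symm 1))) / (g (c.2 (τ.symm 2)) - g (c.2 (τ.symm 1))) : ℂ) : P1),
    (((g (c.2 (τ.symm 0)) - g (c.2 (τ.symm 1))) /
      (g (c.2 (τ.symm 2)) - g (c.2 (τ.symm 1))) : ℂ) : P1),
    ((0 : ℂ) : P1), ((1 : ℂ) : P1), OnePoint.infty]

/-- `M_{0,n}` as a set of tuples. -/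
def moduliSet (n : ℕ) : Set (Fin n → P1) :=
  {X | Function.Injective X ∧
    ∀ i : Fin n, (i.val + 3 = n → X i = ((0 : ℂ) : P1)) ∧
      (i.val + 2 = n → X i = ((1 : ℂ) : P1)) ∧ (i.val + 1 = n → X i = OnePoint.infty)}

/-- An affine normalization of the `g`-images preserves distinctness, so injectivity of `g`
suffices. The rotations can thus be performed among the standard punctures, whatever `X` is. -/
theorem normalize_mapsTo (τ : Equiv.Perm (Fin 3)) {g : ℂ → ℂ} (hg : Function.Injective g) :
    MapsTo (normalize τ g) configurations (moduliSet 5) := by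
  rintro ⟨z, a⟩ ⟨ha, hz⟩
  dsimp only at ha hz
  have h21 : g (a (τ.symm 2)) - g (a (τ.symm 1)) ≠ 0 :=
    sub_ne_zero.2 fun h => by simpa using τ.symm.injective (ha (hg h))
  have h01 : g (a (τ.symm 0)) ≠ g (a (τ.symm 1)) :=
    fun h => by simpa using τ.symm.injective (ha (hg h))
  have h02 : g (a (τ.symm 0)) ≠ g (a (τ.symm 2)) :=
    fun h => by simpa using τ.symm.injective (ha (hg h))
  have hzk : ∀ k, g z ≠ g (a k) := fun k h => hz k (hg h)
  constructor
  · have h1 := hzk (τ.symm 0)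
    have h2 := hzk (τ.symm 1)
    have h3 := hzk (τ.symm 2)
    intro i j hij
    fin_cases i <;> fin_cases j <;>
      simp [normalize, div_eq_iff, eq_div_iff, h21, sub_eq_zero, h01, h02, h1, h2, h3,
        h02.symm, h1.symm, h3.symm, (sub_ne_zero.2 h2).symm, (sub_ne_zero.2 h01).symm] at hij ⊢
  · intro i
    fin_cases i <;> simp [normalize]

theorem continuousOn_normalize (τ : Equiv.Perm (Fin 3)) {g : ℂ → ℂ} (hgc : Continuous g)
    (hg : Function.Injective g) : ContinuousOn (normalize τ g) configurations := by
  have hd : ∀ c ∈ configurations, g (c.2 (τ.symm 2)) - g (c.2 (τ.symm 1)) ≠ 0 := fun c hc =>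
    sub_ne_zero.2 fun h => by simpa using τ.symm.injective (hc.1 (hg h))
  refine continuousOn_pi.2 fun i => ?_
  have h0 : ContinuousOn (fun c : ℂ × (Fin 3 → ℂ) => (g c.1 - g (c.2 (τ.symm 1))) /
      (g (c.2 (τ.symm 2)) - g (c.2 (τ.symm 1)))) configurations :=
    ContinuousOn.div (by fun_prop) (by fun_prop) hd
  have h1 : ContinuousOn (fun c : ℂ × (Fin 3 → ℂ) => (g (c.2 (τ.symm 0)) - g (c.2 (τ.symm 1))) /
      (g (c.2 (τ.symm 2)) - g (c.2 (τ.symm 1)))) configurations :=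
    ContinuousOn.div (by fun_prop) (by fun_prop) hd
  fin_cases i
  · exact OnePoint.continuous_coe.comp_continuousOn h0
  · exact OnePoint.continuous_coe.comp_continuousOn h1
  · exact continuousOn_const
  · exact continuousOn_const
  · exact continuousOn_const

/-- The finite punctures `λ, 0, 1` of a point of `M_{0,4}`. -/
def finitePunctures (X : M0 4) (k : Fin 3) : ℂ := finitePart (X.1 k.castSucc)

theorem M0_infty (X : M0 4) : X.1 3 = OnePoint.infty := (X.2.2 3).2.2 rfl

theorem coe_finitePunctures (X : M0 4) (k : Fin 3) :
    (finitePunctures X k : P1) = X.1 k.castSucc := by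
  refine coe_finitePart fun h => ?_
  have h' := congrArg Fin.val (X.2.1 (h.trans (M0_infty X).symm))
  simp at h'
  omega

theorem finitePunctures_injective (X : M0 4) : Function.Injective (finitePunctures X) := by
  intro k l h
  have : X.1 k.castSucc = X.1 l.castSucc := by
    rw [← coe_finitePunctures, ← coe_finitePunctures, h]
  exact Fin.castSucc_injective _ (X.2.1 this)

theorem finitePunctures_one (X : M0 4) : finitePunctures X 1 = 0 := by
  rw [finitePunctures, show X.1 (Fin.castSucc 1) = ((0 : ℂ) : P1) from (X.2.2 1).1 rfl]
  rfl

theorem finitePunctures_two (X : M0 4) : finitePunctures X 2 = 1 := by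
  rw [finitePunctures, show X.1 (Fin.castSucc 2) = ((1 : ℂ) : P1) from (X.2.2 2).2.1 rfl]
  rfl

/-- The map `g` already puts two of the standard punctures at 0 and 1, so the affine normalization
is the identity here. -/
theorem normalize_nodes (X : M0 4) {τ : Equiv.Perm (Fin 3)} {g : ℂ → ℂ}
    (hg : ∀ k, g (nodes k) = finitePunctures X (τ k)) (z : ℂ) :
    normalize τ g (z, nodes) = Fin.cons (g z : P1) X.1 := by
  have h0 := coe_finitePunctures X 0
  have h1 := coe_finitePunctures X 1
  have h2 := coe_finitePunctures X 2
  have h3 := M0_infty X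
  simp only [finitePunctures_one, finitePunctures_two] at h1 h2
  ext i : 1
  simp only [normalize, hg, Equiv.apply_symm_apply, finitePunctures_one, finitePunctures_two,
    sub_zero, div_one]
  fin_cases i
  exacts [rfl, h0, h1, h2, h3.symm]

/-- The value of a representation on a loop in the fibre, as a holonomy in the standard plane. -/
theorem apply_loop (X : M0 4) (x₀ : Punctured X.1) {G : Type*} [Group G]
    (F : Pi1 (M0 5) (fibre three_le_four X x₀) →* G) {τ : Equiv.Perm (Fin 3)} {g h : ℂ → ℂ}
    (hgc : Continuous g) (hgi : Function.Injective g) (hgh : ∀ z, g (h z) = z)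
    (hg : ∀ k, g (nodes k) = finitePunctures X (τ k)) (l : Path x₀ x₀) :
    F (fibreHom three_le_four X x₀ (Pi1.of l)) =
      ((holonomyOfHom (U := moduliSet 5) F).pullback (normalize τ g)
        (continuousOn_normalize τ hgc hgi) (normalize_mapsTo τ hgi)).fibrewise.val
        fun t => h (finitePart (l.extend t).1) := by
  have h1 := holonomyOfHom_loop (U := moduliSet 5) F
    (l.map (fibre three_le_four X).continuous)
  refine Eq.trans h1.symm ((holonomyOfHom (U := moduliSet 5) F).congr fun t _ => ?_)
  have hne : (l.extend t).1 ≠ OnePoint.infty := fun h' => (l.extend t).2 3 (by rw [h', M0_infty])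
  dsimp only
  rw [normalize_nodes X hg, hgh, coe_finitePart hne]
  rfl

theorem mem_disc_coe {p q : ℂ} {r : ℝ} (h : ‖q - p‖ ≤ r) : (q : P1) ∈ disc (p : P1) r :=
  ⟨q - p, by simpa using h, by simp [param]⟩

/-- The loop along an arc, read in the standard plane, has holonomy conjugate to that of any small
circle around the end of the arc. -/
theorem isConj_of_isLoopAlong {n : ℕ} {X : Fin n → P1} {x₀ : Punctured X} {p : ℂ}
    {c : Path x₀.1 (p : P1)} {r : ℝ} (hr : 0 < r) {a : Pi1 (Punctured X) x₀}
    (ha : IsLoopAlong c r a) {G : Type*} [Group G] (H : Holonomy standardPlane G) {h : ℂ → ℂ}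
    (hh : Continuous h) (hX : OnePoint.infty ∈ range X)
    (hm : ∀ z : ℂ, (∀ j, (z : P1) ≠ X j) → h z ∈ standardPlane)
    (hU : ∀ u : ℂ, u ≠ 0 → ‖u‖ ≤ r → ∀ j, ((p + u : ℂ) : P1) ≠ X j) {w : ℂ} (hw : w ≠ 0)
    (hwr : ‖w‖ ≤ r) :
    ∃ l : Path x₀ x₀, a = Pi1.of l ∧
      IsConj (H.val fun t => h (finitePart (l.extend t).1)) (H.val fun t => h (circleAt p w t)) := by
  obtain ⟨-, w₀, q, β, δ, hw₀, -, -, -, -, hδ, rfl⟩ := ha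
  refine ⟨_, rfl, ?_⟩
  have hne : ∀ y : P1, (∀ j, y ≠ X j) → y ≠ OnePoint.infty := fun y hy => by
    obtain ⟨j, hj⟩ := hX
    exact hj ▸ hy j
  have hf : ContinuousOn (fun y : P1 => h (finitePart y)) {y | ∀ j, y ≠ X j} :=
    hh.comp_continuousOn (continuousOn_finitePart.mono fun y hy => hne y hy)
  have hmaps : MapsTo (fun y : P1 => h (finitePart y)) {y | ∀ j, y ≠ X j} standardPlane :=
    fun y hy => hm _ (by rwa [coe_finitePart (hne y hy)])
  have e1 := H.val_trans hf hmaps (β.trans δ) β.symm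
  have e2 := H.val_trans hf hmaps β δ
  have e3 := H.val_symm hf hmaps β
  have e4 : H.val (fun t => h (finitePart (δ.extend t).1)) =
      H.val fun t => h (circleAt p w₀ t) := by
    refine H.congr fun t ht => ?_
    rw [Path.extend_apply _ ht, hδ]
    rfl
  have hconj := H.isConj_circle hh (p := p) (norm_pos_iff.1 (hw₀ ▸ hr)) hw (hw₀ ▸ hwr)
    fun u hu hur => hm _ (hU u hu (hw₀ ▸ hur))
  -- The arc leading to the circle and back only contributes a conjugation.
  refine IsConj.trans ?_ hconj
  rw [← e4, isConj_comm, isConj_iff]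
  refine ⟨H.val fun t => h (finitePart (β.extend t).1), ?_⟩
  rw [← e3]
  exact (e1.trans (congrArg (· * _) e2)).symm

theorem IsLoopAlong.exists_loop {n : ℕ} {X : Fin n → P1} {x₀ : Punctured X} {y : P1}
    {c : Path x₀.1 y} {r : ℝ} {a : Pi1 (Punctured X) x₀} (ha : IsLoopAlong c r a) :
    ∃ l : Path x₀ x₀, a = Pi1.of l := by
  obtain ⟨-, -, -, β, δ, -, -, -, -, -, -, rfl⟩ := ha
  exact ⟨_, rfl⟩

/-! ### Non-existence of the extension, and its consequences -/

/-- A homomorphism to `S₃` that takes a geometric basis to transpositions, not all equal, does not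
extend to the fundamental group of `M_{0,5}`. -/
theorem not_exists_extension (X : M0 4) (x₀ : Punctured X.1)
    (α : Fin 4 → Pi1 (Punctured X.1) x₀) (hα : IsGeometricBasis X.1 x₀ α)
    (f : Pi1 (Punctured X.1) x₀ →* Equiv.Perm (Fin 3)) (hf : ∀ i, f (α i) = thetaVal i) :
    ¬ ∃ F : Pi1 (M0 5) (fibre three_le_four X x₀) →* Equiv.Perm (Fin 3),
      F.comp (fibreHom three_le_four X x₀) = f := by
  rintro ⟨F, hF⟩
  obtain ⟨ρ, c, -, r, -, -, -, -, -, hr, hdisj, -, hloop⟩ := hα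
  have hpinf := coe_finitePunctures X
  have hinf := M0_infty X
  obtain ⟨τ, g, h, hgc, hhc, hgh, hhg, hnode, hsmall⟩ :=
    exists_straightening (finitePunctures_injective X)
  have hgi : Function.Injective g := Function.LeftInverse.injective hhg
  have hap := apply_loop X x₀ F hgc hgi hgh hnode
  set H := (holonomyOfHom (U := moduliSet 5) F).pullback (normalize τ g)
        (continuousOn_normalize τ hgc hgi) (normalize_mapsTo τ hgi)
  have hFf : ∀ a, F (fibreHom three_le_four X x₀ a) = f a := fun a => DFunLike.congr_fun hF a
  have hm : ∀ z : ℂ, (∀ j, (z : P1) ≠ X.1 j) → h z ∈ standardPlane := by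
    intro z hz k hk
    refine hz (τ k).castSucc ?_
    rw [← hpinf, ← hnode, ← hgh z]
    exact congrArg (fun y => (g y : P1)) hk
  have hsign : ∀ j < 3,
      Equiv.Perm.sign (H.fibrewise.jump j * (H.fibrewise.jump (j + 1))⁻¹) = -1 := by
    intro j hj
    lift j to Fin 3 using hj
    -- The basis element whose arc ends at the puncture corresponding to the standard one with index
    -- `j`.
    obtain ⟨i, hi⟩ := ρ.surjective (τ j).castSucc
    obtain ⟨w, hw, hwr, h0, hh, h1, h2⟩ := hsmall j (r i) (hr i)
    have hXi : X.1 (ρ i) = (finitePunctures X (τ j) : P1) := by rw [hi, hpinf]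
    have hU : ∀ u : ℂ, u ≠ 0 → ‖u‖ ≤ r i → ∀ l,
        ((finitePunctures X (τ j) + u : ℂ) : P1) ≠ X.1 l := by
      intro u hu hur l hl
      obtain ⟨i', rfl⟩ := ρ.surjective l
      have hmem : X.1 (ρ i') ∈ disc (X.1 (ρ i)) (r i) := by
        rw [hXi, ← hl]
        exact mem_disc_coe (by simpa using hur)
      have hmem' : X.1 (ρ i') ∈ disc (X.1 (ρ i')) (r i') := by
        rw [← hl]
        exact mem_disc_coe (by simpa using (hr i').le)
      by_cases hii : i = i'
      · subst hii
        rw [hXi] at hl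
        exact hu (by simpa using OnePoint.coe_injective hl)
      · exact disjoint_left.1 (hdisj i i' hii) hmem hmem'
    have key : ∀ (y : P1) (c : Path x₀.1 y), IsLoopAlong c (r i) (α i) →
        y = (finitePunctures X (τ j) : P1) →
        ∃ l : Path x₀ x₀, α i = Pi1.of l ∧
          IsConj (H.fibrewise.val fun t => h (finitePart (l.extend t).1))
            (H.fibrewise.val fun t => h (circleAt (finitePunctures X (τ j)) w t)) := by
      rintro y c hc rfl
      exact isConj_of_isLoopAlong (hr i) hc H.fibrewise hhc ⟨3, hinf⟩ hm hU hw hwr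
    obtain ⟨l, hl, hconj⟩ := key _ _ (hloop i) hXi
    have hjump := Holonomy.isConj_jump (H := H.fibrewise) j.2
      (c := fun t => h (circleAt (finitePunctures X (τ j)) w t)) (by fun_prop) h1 h2
      (by simp [circleAt]) h0 hh
    -- The value of `f` is known only up to conjugacy after transport to a circle; the sign is
    -- insensitive to this.
    have hs := (Equiv.Perm.sign.map_isConj (hconj.trans hjump))
    rw [isConj_iff_eq, ← hap, ← hl, hFf, hf] at hs
    exact hs ▸ (by decide : ∀ i, Equiv.Perm.sign (thetaVal i) = -1) i
  obtain ⟨A, s, hA⟩ := H.exists_potential_of_sign hsign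
  have hmem : ∀ i, A (h (finitePart x₀.1)) * thetaVal i * (A (h (finitePart x₀.1)))⁻¹ ∈
      Subgroup.zpowers s := by
    intro i
    obtain ⟨l, hl⟩ := (hloop i).exists_loop
    have hne : ∀ y : P1, (∀ j, y ≠ X.1 j) → y ≠ OnePoint.infty := fun y hy => hinf ▸ hy 3
    have h1 := hA (fun t => h (finitePart (l.extend t).1))
      (hhc.comp_continuousOn (continuousOn_finitePart.comp (by fun_prop)
        fun t _ => hne _ (l.extend t).2))
      fun t _ => hm _ (by
        rw [coe_finitePart (hne _ (l.extend t).2)]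
        exact (l.extend t).2)
    rw [← hap, ← hl, hFf, hf] at h1
    simpa using h1
  obtain ⟨m, hm0⟩ := hmem 0
  obtain ⟨m', hm1⟩ := hmem 1
  -- A common conjugation puts (12) and (23) into one cyclic group, so they would commute.
  have hcomm : Commute (A (h (finitePart x₀.1)) * thetaVal 0 * (A (h (finitePart x₀.1)))⁻¹)
      (A (h (finitePart x₀.1)) * thetaVal 1 * (A (h (finitePart x₀.1)))⁻¹) := by
    rw [← hm0, ← hm1]
    exact (Commute.refl s).zpow_zpow m m'
  exact absurd ((Commute.conj_iff _).1 hcomm).eq (by decide)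

/-- A homeomorphism induces a surjection on fundamental groups. -/
theorem range_mapOfEq_of_isHomeomorph {Y B : Type*} [TopologicalSpace Y] [TopologicalSpace B]
    {q : C(Y, B)} (hq : IsHomeomorph q) {y : Y} {b : B} (h : q y = b) :
    (Pi1.mapOfEq q h).range = ⊤ := by
  subst h
  rw [MonoidHom.range_eq_top]
  let e := hq.homeomorph
  intro a
  obtain ⟨a, rfl⟩ := MulOpposite.op_surjective a
  obtain ⟨l, rfl⟩ := Path.Homotopic.Quotient.mk_surjective a
  have hey : e.symm (q y) = y := e.symm_apply_apply y
  refine ⟨Pi1.of ((l.map e.symm.continuous).cast hey.symm hey.symm),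
    MulOpposite.unop_injective ((FundamentalGroup.mapOfEq_apply q rfl _).trans ?_)⟩
  refine congrArg Path.Homotopic.Quotient.mk (?_ : Path.map _ q.continuous = l)
  ext t
  exact e.apply_symm_apply (l t)

end GCurves

end

theorem mainTheorem8 (X : M0 4) (x₀ : Punctured X.1)
    (α : Fin 4 → Pi1 (Punctured X.1) x₀)
    (hα : IsGeometricBasis X.1 x₀ α)
    (χ : Gam 4 ≃* Pi1 (Punctured X.1) x₀)
    (hχ : ∀ i, χ (Gam.gen i) = α i)
    (f : Pi1 (Punctured X.1) x₀ →* Equiv.Perm (Fin 3))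
    (hf : f = theta.comp χ.symm.toMonoidHom) :
    (¬ ∃ F : Pi1 (M0 5) (fibre three_le_four X x₀) →* Equiv.Perm (Fin 3),
        F.comp (fibreHom three_le_four X x₀) = f) ∧
    (∀ (ε : Pi1 (M0 4) X →* MulAut (Pi1 (Punctured X.1) x₀))
        (e : Pi1 (Punctured X.1) x₀ ⋊[ε] Pi1 (M0 4) X ≃*
          Pi1 (M0 5) (fibre three_le_four X x₀)),
        e.toMonoidHom.comp SemidirectProduct.inl = fibreHom three_le_four X x₀ →
        (projHom three_le_four X x₀).comp e.toMonoidHom = SemidirectProduct.rightHom →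
        ¬ ∃ F : Pi1 (Punctured X.1) x₀ ⋊[ε] Pi1 (M0 4) X →*
            Equiv.Perm (Fin 3),
          F.comp SemidirectProduct.inl = f) ∧
    (∀ a : Extension (fibreHom three_le_four X x₀) (projHom three_le_four X x₀) f,
        a.Ha ≠ ⊤ ∧
        ∀ (Y : Type*) [TopologicalSpace Y] (q : C(Y, M0 4)) (y : Y),
          IsCoveringOf a.Ha q y → ¬ IsHomeomorph q) := by
  have hfα : ∀ i, f (α i) = thetaVal i := fun i => by
    rw [hf, ← hχ, ← theta_gen]
    exact congrArg theta (χ.symm_apply_apply _)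
  have main := not_exists_extension X x₀ α hα f hfα
  refine ⟨main, ?_, ?_⟩
  · rintro ε e he - ⟨F, hF⟩
    refine main ⟨F.comp e.symm.toMonoidHom, ?_⟩
    rw [← he, ← hF]
    ext1 n
    exact congrArg F (e.symm_apply_apply _)
  · intro a
    have hne : a.Ha ≠ ⊤ := by
      intro htop
      -- The preimage of the full group is everything, so `a.fa` becomes a forbidden extension.
      have hall : ∀ k, k ∈ a.Ha.comap (projHom three_le_four X x₀) := fun k => by
        rw [Subgroup.mem_comap, htop]
        exact Subgroup.mem_top _
      refine main ⟨a.fa.comp ((MonoidHom.id _).codRestrict _ hall), ?_⟩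
      ext1 n
      obtain ⟨hn, h⟩ := a.extends_f n
      exact h
    refine ⟨hne, fun Y _ q y hq hh => hne ?_⟩
    obtain ⟨-, -, h, hrange⟩ := hq
    rw [← hrange, range_mapOfEq_of_isHomeomorph hh]
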